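/- Let $n\ge 1$, $m=\lfloor n/2\rfloor$, let $W$ be the complex vector space with basis $f_1,\dots,f_m$, and let $\wedge^\bullet W$ have the basis $f_\alpha=f_{\alpha_1}\wedge\cdots\wedge f_{\alpha_h}$, $\alpha=\{\alpha_1<\cdots<\alpha_h\}\subset\{1,\dots,m\}$. If $n=2m$, put $\mathbb S^+=\wedge^{\rm even}W$ and $\mathbb S^-=\wedge^{\rm odd}W$; if $n=2m+1$, put $\mathbb S^+=\mathbb S^-=\wedge^\bullet W$. For $1\le k\le m$ let $\gamma(f_k)$ be exterior multiplication by $f_k$ from the left, and let $\gamma(\bar f_k)$ be the contraction that sends $f_\alpha$ to $0$ if $k\notin\alpha$ and to $(-1)^{t+1}f_{\alpha\setminus\{k\}}$ if $k=\alpha_t$. The Dirac matrices $\gamma_j:\mathbb S^+\to\mathbb S^-$, $1\le j\le n$, are $$\gamma_{2k-1}=\gamma(f_k)-\gamma(\bar f_k),\qquad \gamma_{2k}=-\mathbf i\,\bigl(\gamma(f_k)+\gamma(\bar f_k)\bigr)\qquad(1\le k\le m),$$ and, if $n=2m+1$, also $\gamma_{2m+1}f_\alpha=-\mathbf i\,(-1)^{\#\alpha}f_\alpha$.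 Write points of $\mathbb R^{2n}$ as $\mathbf x=(\mathbf x_0,\mathbf x_1)$ with $\mathbf x_A=(x_{A1},\dots,x_{An})$, and for an $\mathbb S^+$-valued function $u$ put $$\mathscr D_0u=(\nabla_0u,\nabla_1u),\qquad \nabla_Au=\sum_{j=1}^n\gamma_j\,\frac{\partial u}{\partial x_{Aj}}\qquad(A=0,1).$$ For an open set $V\subset\mathbb R^{2n}$, let $\mathcal O(V)$ be the set of monogenic functions on $V$, i.e. of the (real) differentiable functions $u:V\to\mathbb S^+$ with $\mathscr D_0u(\mathbf x)=0$ for every $\mathbf x\in V$. **Theorem (Hartogs' extension phenomenon).** Let $\Omega$ be an open set in $\mathbb R^{2n}$ and let $K$ be a compact subset of $\Omega$ such that $\Omega\setminus K$ is connected. Then for each $u\in\mathcal O(\Omega\setminus K)$ there is $U\in\mathcal O(\Omega)$ such that $U=u$ in $\Omega\setminus K$. -/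

import Mathlib

noncomputable section

/-- The complexified exterior algebra of the `m`-dimensional space `W` with basis `f_0, …, f_{m-1}`,
where `m = ⌊n/2⌋`. A spinor is given by its coordinates in the basis
`f_α = f_{α_1} ∧ ⋯ ∧ f_{α_h}` (`α_1 < ⋯ < α_h`) indexed by the subsets `α` of `{0, …, m-1}`;
this basis is orthonormal for the Hermitian inner product. -/
abbrev Spinor (n : ℕ) : Type := EuclideanSpace ℂ (Finset (Fin (n / 2)))

/-- The sign `(-1)^t`, where `t` is the number of elements of `α` that are smaller than `k`. -/
def wedgeSign {m : ℕ} (k : Fin m) (α : Finset (Fin m)) : ℂ := (-1) ^ (α.filter (· < k)).card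

/-- The basis vector `f_α`. -/
def spinorBasis (n : ℕ) (α : Finset (Fin (n / 2))) : Spinor n := EuclideanSpace.single α 1

/-- The action of `f_k`: exterior multiplication `ψ ↦ f_k ∧ ψ`, in coordinates
(on basis vectors, see `wedgeOp_basis`). -/
def wedgeOp {n : ℕ} (k : Fin (n / 2)) : Spinor n →ₗ[ℂ] Spinor n where
  toFun ψ := WithLp.toLp 2 fun β => if k ∈ β then wedgeSign k β * ψ (β.erase k) else 0
  map_add' ψ φ := by ext β; by_cases h : k ∈ β <;> simp [h, mul_add]
  map_smul' c ψ := by ext β; by_cases h : k ∈ β <;> simp [h, mul_left_comm]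

/-- The action of `f̄_k`: contraction, in coordinates
(on basis vectors, see `contractOp_basis`). -/
def contractOp {n : ℕ} (k : Fin (n / 2)) : Spinor n →ₗ[ℂ] Spinor n where
  toFun ψ := WithLp.toLp 2 fun β => if k ∈ β then 0 else wedgeSign k β * ψ (insert k β)
  map_add' ψ φ := by ext β; by_cases h : k ∈ β <;> simp [h, mul_add]
  map_smul' c ψ := by ext β; by_cases h : k ∈ β <;> simp [h, mul_left_comm]

/-- The parity operator `f_α ↦ (-1)^{#α} f_α`; it is the action of `f_{m+1} = i e_{2m+1}` when
`n = 2m+1`. -/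
def parityOp {n : ℕ} : Spinor n →ₗ[ℂ] Spinor n where
  toFun ψ := WithLp.toLp 2 fun β => (-1) ^ β.card * ψ β
  map_add' ψ φ := by ext β; simp [mul_add]
  map_smul' c ψ := by ext β; simp [mul_left_comm]

/-- The Dirac matrices `γ(e_j)`, with the index `j` running over `0, …, n-1`. The vectors
`e` (at places `2k` and `2k+1`) are `f_k - f̄_k` and `-i (f_k + f̄_k)`, and for `n = 2m+1` the
last one (at place `2m`) is `-i f_{m+1}`. -/
def diracMatrix {n : ℕ} (j : Fin n) : Spinor n →ₗ[ℂ] Spinor n :=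
  if h : (j : ℕ) / 2 < n / 2 then
    if (j : ℕ) % 2 = 0 then wedgeOp ⟨(j : ℕ) / 2, h⟩ - contractOp ⟨(j : ℕ) / 2, h⟩
    else (-Complex.I) • (wedgeOp ⟨(j : ℕ) / 2, h⟩ + contractOp ⟨(j : ℕ) / 2, h⟩)
  else (-Complex.I) • parityOp

/-- `𝕊⁺`: the even part of the exterior algebra if `n` is even, all of it if `n` is odd. -/
def spinPlus (n : ℕ) : Submodule ℂ (Spinor n) where
  carrier := {ψ | Even n → ∀ α, Odd α.card → ψ α = 0}
  add_mem' := fun ha hb hn α hα => by simp [ha hn α hα, hb hn α hα]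
  zero_mem' := fun _ _ _ => rfl
  smul_mem' := fun c ψ h hn α hα => by simp [h hn α hα]

/-- `𝕊⁻`: the odd part of the exterior algebra if `n` is even, all of it if `n` is odd. -/
def spinMinus (n : ℕ) : Submodule ℂ (Spinor n) where
  carrier := {ψ | Even n → ∀ α, Even α.card → ψ α = 0}
  add_mem' := fun ha hb hn α hα => by simp [ha hn α hα, hb hn α hα]
  zero_mem' := fun _ _ _ => rfl
  smul_mem' := fun c ψ h hn α hα => by simp [h hn α hα]

theorem wedgeSign_insert {m : ℕ} (k l : Fin m) (β : Finset (Fin m)) (hl : l ∉ β) :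
    wedgeSign k (insert l β) = if l < k then -wedgeSign k β else wedgeSign k β := by
  unfold wedgeSign
  rw [Finset.filter_insert]
  split_ifs with h
  · rw [Finset.card_insert_of_notMem (by simp [hl]), pow_succ]; ring
  · rfl

theorem wedgeSign_erase {m : ℕ} (k l : Fin m) (β : Finset (Fin m)) (hl : l ∈ β) :
    wedgeSign k (β.erase l) = if l < k then -wedgeSign k β else wedgeSign k β := by
  have h := wedgeSign_insert k l (β.erase l) (by simp)
  rw [Finset.insert_erase hl] at h
  rw [h]
  split_ifs <;> simp

theorem wedgeSign_mul_self {m : ℕ} (k : Fin m) (β : Finset (Fin m)) :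
    wedgeSign k β * wedgeSign k β = 1 := by
  unfold wedgeSign
  rw [← mul_pow]; simp

theorem wedgeOp_apply {n : ℕ} (k : Fin (n / 2)) (ψ : Spinor n) (β : Finset (Fin (n / 2))) :
    wedgeOp k ψ β = if k ∈ β then wedgeSign k β * ψ (β.erase k) else 0 := rfl

theorem contractOp_apply {n : ℕ} (k : Fin (n / 2)) (ψ : Spinor n) (β : Finset (Fin (n / 2))) :
    contractOp k ψ β = if k ∈ β then 0 else wedgeSign k β * ψ (insert k β) := rfl

theorem parityOp_apply {n : ℕ} (ψ : Spinor n) (β : Finset (Fin (n / 2))) :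
    parityOp ψ β = (-1) ^ β.card * ψ β := rfl

/-- `f_k ∧ f_α`. -/
theorem wedgeOp_basis {n : ℕ} (k : Fin (n / 2)) (α : Finset (Fin (n / 2))) :
    wedgeOp k (spinorBasis n α) =
      if k ∈ α then 0 else wedgeSign k α • spinorBasis n (insert k α) := by
  ext β
  rw [wedgeOp_apply]
  by_cases hα : k ∈ α
  · have : β.erase k ≠ α := by rintro rfl; simp at hα
    simp [hα, spinorBasis, this]
  · by_cases hβ : k ∈ β
    · by_cases he : β.erase k = α
      · have h1 : β = insert k α := by rw [← he, Finset.insert_erase hβ]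
        have h2 := wedgeSign_insert k k α hα
        simp only [lt_irrefl, if_false] at h2
        subst h1
        simp [hα, spinorBasis, h2]
      · have : β ≠ insert k α := by rintro rfl; simp [hα] at he
        simp [hα, hβ, spinorBasis, this, he]
    · have : β ≠ insert k α := by rintro rfl; simp at hβ
      simp [hα, hβ, spinorBasis, this]

/-- Contraction of `f_α`: the sign is `(-1)^{t-1}` if `k` is the `t`-th element of `α`. -/
theorem contractOp_basis {n : ℕ} (k : Fin (n / 2)) (α : Finset (Fin (n / 2))) :
    contractOp k (spinorBasis n α) =
      if k ∈ α then wedgeSign k α • spinorBasis n (α.erase k) else 0 := by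
  ext β
  rw [contractOp_apply]
  by_cases hβ : k ∈ β
  · have : β ≠ α.erase k := by rintro rfl; simp at hβ
    by_cases hα : k ∈ α <;> simp [hα, hβ, spinorBasis, this]
  · by_cases he : insert k β = α
    · subst he
      have h2 := wedgeSign_insert k k β hβ
      simp only [lt_irrefl, if_false] at h2
      simp [hβ, spinorBasis, h2]
    · by_cases hα : k ∈ α
      · have : β ≠ α.erase k := by rintro rfl; exact he (Finset.insert_erase hα)
        simp [hα, hβ, spinorBasis, this, he]
      · simp [hα, hβ, spinorBasis, he]

theorem wedgeOp_wedgeOp {n : ℕ} (k l : Fin (n / 2)) :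
    (wedgeOp k * wedgeOp l + wedgeOp l * wedgeOp k : Module.End ℂ (Spinor n)) = 0 := by
  ext ψ β
  simp only [LinearMap.add_apply, Module.End.mul_apply, PiLp.add_apply, wedgeOp_apply,
    LinearMap.zero_apply, PiLp.zero_apply]
  rcases eq_or_ne k l with rfl | hkl
  · simp
  by_cases hk : k ∈ β <;> by_cases hl : l ∈ β <;> simp [hk, hl, hkl, hkl.symm]
  rw [wedgeSign_erase l k β hk, wedgeSign_erase k l β hl, Finset.erase_right_comm]
  rcases lt_or_gt_of_ne hkl with h | h <;> simp [h, not_lt.2 h.le] <;> ring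

theorem contractOp_contractOp {n : ℕ} (k l : Fin (n / 2)) :
    (contractOp k * contractOp l + contractOp l * contractOp k :
      Module.End ℂ (Spinor n)) = 0 := by
  ext ψ β
  simp only [LinearMap.add_apply, Module.End.mul_apply, PiLp.add_apply, contractOp_apply,
    LinearMap.zero_apply, PiLp.zero_apply]
  rcases eq_or_ne k l with rfl | hkl
  · simp
  by_cases hk : k ∈ β <;> by_cases hl : l ∈ β <;> simp [hk, hl, hkl, hkl.symm]
  rw [wedgeSign_insert l k β hk, wedgeSign_insert k l β hl, Finset.insert_comm]
  rcases lt_or_gt_of_ne hkl with h | h <;> simp [h, not_lt.2 h.le] <;> ring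

theorem wedgeOp_contractOp {n : ℕ} (k l : Fin (n / 2)) :
    (wedgeOp k * contractOp l + contractOp l * wedgeOp k : Module.End ℂ (Spinor n)) =
      if k = l then 1 else 0 := by
  ext ψ β
  simp only [LinearMap.add_apply, Module.End.mul_apply, PiLp.add_apply, wedgeOp_apply,
    contractOp_apply]
  rcases eq_or_ne k l with rfl | hkl
  · by_cases hk : k ∈ β
    · simp [hk, wedgeSign_erase, Finset.insert_erase, ← mul_assoc, wedgeSign_mul_self]
    · simp [hk, wedgeSign_insert, ← mul_assoc, wedgeSign_mul_self]
  · by_cases hk : k ∈ β <;> by_cases hl : l ∈ β <;> simp [hk, hl, hkl, hkl.symm]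
    rw [wedgeSign_erase l k β hk, wedgeSign_insert k l β hl, Finset.erase_insert_of_ne hkl.symm]
    rcases lt_or_gt_of_ne hkl with h | h <;> simp [h, not_lt.2 h.le] <;> ring

theorem parityOp_wedgeOp {n : ℕ} (k : Fin (n / 2)) :
    (parityOp * wedgeOp k + wedgeOp k * parityOp : Module.End ℂ (Spinor n)) = 0 := by
  ext ψ β
  simp only [LinearMap.add_apply, Module.End.mul_apply, PiLp.add_apply, wedgeOp_apply,
    parityOp_apply, LinearMap.zero_apply, PiLp.zero_apply]
  by_cases hk : k ∈ β <;> simp only [hk, if_true, if_false, mul_zero, add_zero]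
  rw [← Finset.card_erase_add_one hk, pow_succ]; ring

theorem parityOp_contractOp {n : ℕ} (k : Fin (n / 2)) :
    (parityOp * contractOp k + contractOp k * parityOp : Module.End ℂ (Spinor n)) = 0 := by
  ext ψ β
  simp only [LinearMap.add_apply, Module.End.mul_apply, PiLp.add_apply, contractOp_apply,
    parityOp_apply, LinearMap.zero_apply, PiLp.zero_apply]
  by_cases hk : k ∈ β <;> simp [hk]
  rw [pow_succ]; ring

theorem parityOp_parityOp {n : ℕ} : (parityOp * parityOp : Module.End ℂ (Spinor n)) = 1 := by
  ext ψ β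
  simp only [Module.End.mul_apply, parityOp_apply, Module.End.one_apply]
  rw [← mul_assoc, ← mul_pow]; simp

theorem diracMatrix_cases {n : ℕ} (j : Fin n) :
    (∃ k : Fin (n / 2), (j : ℕ) = 2 * k ∧ diracMatrix j = wedgeOp k - contractOp k) ∨
    (∃ k : Fin (n / 2), (j : ℕ) = 2 * k + 1 ∧
      diracMatrix j = (-Complex.I) • (wedgeOp k + contractOp k)) ∨
    ((j : ℕ) = 2 * (n / 2) ∧ diracMatrix j = (-Complex.I) • parityOp) := by
  have hj := j.2
  by_cases h : (j : ℕ) / 2 < n / 2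
  · by_cases h2 : (j : ℕ) % 2 = 0
    · exact Or.inl ⟨⟨_, h⟩, by simp only; omega, by rw [diracMatrix, dif_pos h, if_pos h2]⟩
    · exact Or.inr (Or.inl ⟨⟨_, h⟩, by simp only; omega,
        by rw [diracMatrix, dif_pos h, if_neg h2]⟩)
  · exact Or.inr (Or.inr ⟨by omega, by rw [diracMatrix, dif_neg h]⟩)

/-- The Clifford relations `γ_i γ_j + γ_j γ_i = -2 δ_{ij}`. -/
theorem diracMatrix_anticomm {n : ℕ} (i j : Fin n) :
    diracMatrix i * diracMatrix j + diracMatrix j * diracMatrix i =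
      if i = j then (-2 : ℂ) • (1 : Module.End ℂ (Spinor n)) else 0 := by
  have hI : Complex.I * Complex.I = -1 := Complex.I_mul_I
  rcases diracMatrix_cases i with ⟨k, hi, ei⟩ | ⟨k, hi, ei⟩ | ⟨hi, ei⟩ <;>
  rcases diracMatrix_cases j with ⟨l, hj, ej⟩ | ⟨l, hj, ej⟩ | ⟨hj, ej⟩ <;>
  rw [ei, ej] <;>
  simp only [sub_mul, mul_sub, add_mul, mul_add, smul_mul_assoc, mul_smul_comm, smul_smul,
    smul_add, smul_sub, neg_mul_neg, hI]
  · have e : i = j ↔ k = l := by rw [Fin.ext_iff, Fin.ext_iff]; omega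
    have h1 := wedgeOp_wedgeOp k l
    have h2 := contractOp_contractOp k l
    have h3 := wedgeOp_contractOp k l
    have h4 : (wedgeOp l * contractOp k + contractOp k * wedgeOp l : Module.End ℂ (Spinor n)) =
        if k = l then 1 else 0 := by
      rw [wedgeOp_contractOp l k]; simp only [eq_comm]
    simp only [e]
    by_cases hkl : k = l <;> simp only [hkl, if_true, if_false] at h1 h2 h3 h4 ⊢ <;>
      linear_combination (norm := module) h1 + h2 - h3 - h4
  · have e : i ≠ j := by rw [Ne, Fin.ext_iff]; omega
    have h1 := wedgeOp_wedgeOp k l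
    have h2 := contractOp_contractOp k l
    have h3 := wedgeOp_contractOp k l
    have h4 : (wedgeOp l * contractOp k + contractOp k * wedgeOp l : Module.End ℂ (Spinor n)) =
        if k = l then 1 else 0 := by
      rw [wedgeOp_contractOp l k]; simp only [eq_comm]
    rw [if_neg e]
    linear_combination (norm := module) (-Complex.I) • (h1 - h2 + h3 - h4)
  · have e : i ≠ j := by rw [Ne, Fin.ext_iff]; omega
    have h1 := parityOp_wedgeOp k
    have h2 := parityOp_contractOp k
    rw [if_neg e]
    linear_combination (norm := module) (-Complex.I) • (h1 - h2)
  · have e : i ≠ j := by rw [Ne, Fin.ext_iff]; omega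
    have h1 := wedgeOp_wedgeOp k l
    have h2 := contractOp_contractOp k l
    have h3 := wedgeOp_contractOp k l
    have h4 : (wedgeOp l * contractOp k + contractOp k * wedgeOp l : Module.End ℂ (Spinor n)) =
        if k = l then 1 else 0 := by
      rw [wedgeOp_contractOp l k]; simp only [eq_comm]
    rw [if_neg e]
    linear_combination (norm := module) (-Complex.I) • (h1 - h2 - h3 + h4)
  · have e : i = j ↔ k = l := by rw [Fin.ext_iff, Fin.ext_iff]; omega
    have h1 := wedgeOp_wedgeOp k l
    have h2 := contractOp_contractOp k l
    have h3 := wedgeOp_contractOp k l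
    have h4 : (wedgeOp l * contractOp k + contractOp k * wedgeOp l : Module.End ℂ (Spinor n)) =
        if k = l then 1 else 0 := by
      rw [wedgeOp_contractOp l k]; simp only [eq_comm]
    simp only [e]
    by_cases hkl : k = l <;> simp only [hkl, if_true, if_false] at h1 h2 h3 h4 ⊢ <;>
      linear_combination (norm := module) (-1 : ℂ) • (h1 + h2 + h3 + h4)
  · have e : i ≠ j := by rw [Ne, Fin.ext_iff]; omega
    have h1 := parityOp_wedgeOp k
    have h2 := parityOp_contractOp k
    rw [if_neg e]
    linear_combination (norm := module) (-1 : ℂ) • (h1 + h2)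
  · have e : i ≠ j := by rw [Ne, Fin.ext_iff]; omega
    have h1 := parityOp_wedgeOp l
    have h2 := parityOp_contractOp l
    rw [if_neg e]
    linear_combination (norm := module) (-Complex.I) • (h1 - h2)
  · have e : i ≠ j := by rw [Ne, Fin.ext_iff]; omega
    have h1 := parityOp_wedgeOp l
    have h2 := parityOp_contractOp l
    rw [if_neg e]
    linear_combination (norm := module) (-1 : ℂ) • (h1 + h2)
  · have e : i = j := by rw [Fin.ext_iff]; omega
    rw [if_pos e, parityOp_parityOp]
    module

theorem diracMatrix_mem {n : ℕ} (j : Fin n) :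
    ∀ ψ ∈ spinPlus n, diracMatrix j ψ ∈ spinMinus n := by
  intro ψ hψ hn α hα
  have hψ' := hψ hn
  have hj : (j : ℕ) / 2 < n / 2 := by
    obtain ⟨r, hr⟩ := hn
    have := j.2
    omega
  have h1 : ∀ k, wedgeOp k ψ α = 0 := fun k => by
    rw [wedgeOp_apply]
    split_ifs with hk
    · have h := Finset.card_erase_add_one hk
      rw [hψ' _ (by rw [← h] at hα; simpa [Nat.even_add_one] using hα), mul_zero]
    · rfl
  have h2 : ∀ k, contractOp k ψ α = 0 := fun k => by
    rw [contractOp_apply]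
    split_ifs with hk
    · rfl
    · rw [hψ' _ (by rw [Finset.card_insert_of_notMem hk]; exact hα.add_one), mul_zero]
  unfold diracMatrix
  rw [dif_pos hj]
  split_ifs <;> simp [h1, h2]

/-- The Dirac matrix `γ_j` as a map `𝕊⁺ → 𝕊⁻`. -/
def gammaPlus {n : ℕ} (j : Fin n) : spinPlus n →ₗ[ℂ] spinMinus n :=
  (diracMatrix j).restrict (diracMatrix_mem j)

/-- `ℝ^{2n}`, with coordinates `x_{Aj}`, `A ∈ {0, 1}`, `j ∈ {0, …, n-1}`. -/
abbrev TwoVec (n : ℕ) : Type := EuclideanSpace ℝ (Fin 2 × Fin n)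

/-- The partial derivative `∂_{Aj} u`. -/
def partialD {n : ℕ} (A : Fin 2) (j : Fin n) (u : TwoVec n → spinPlus n) (x : TwoVec n) :
    spinPlus n :=
  fderiv ℝ u x (EuclideanSpace.single (A, j) 1)

/-- `∇_A u = ∑_j γ_j ∂_{Aj} u`. -/
def nablaD {n : ℕ} (A : Fin 2) (u : TwoVec n → spinPlus n) (x : TwoVec n) : spinMinus n :=
  ∑ j : Fin n, gammaPlus j (partialD A j u x)

/-- `𝒟₀ u = (∇_0 u, ∇_1 u)`, with values in `ℂ² ⊗ 𝕊⁻`, written as pairs of elements of `𝕊⁻`. -/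
def diracDZero {n : ℕ} (u : TwoVec n → spinPlus n) (x : TwoVec n) : Fin 2 → spinMinus n :=
  fun A => nablaD A u x

/-- `u` is monogenic on the open set `s`: it is (real) differentiable at each point of `s` and
satisfies `𝒟₀ u = 0` there. The values of `u` outside `s` are irrelevant. -/
structure IsMonogenicOn {n : ℕ} (u : TwoVec n → spinPlus n) (s : Set (TwoVec n)) : Prop where
  differentiableAt : ∀ x ∈ s, DifferentiableAt ℝ u x
  eq_zero : ∀ x ∈ s, diracDZero u x = 0

end

open MeasureTheory Set Metric Filter Topology Function
open scoped FourierTransform LineDeriv SchwartzMap ContDiff Manifold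

set_option linter.unusedSectionVars false

/-! The argument is Ehrenpreis's: cut off, correct by a solution of the inhomogeneous system that
decays at infinity, and show that the correction vanishes somewhere in `Ω \ K`.

Let `D_A` be the Dirac operator in the vector variable `x_A`, acting on functions with values in the
whole spinor space. The Clifford relations give `D_A² = -Δ_A`, so `D_0² + D_1² = -Δ` on `ℝ^{2n}`.
Take a cutoff `χ` equal to `1` near `K`, put `f = (1 - χ) u`, extended by zero across `K`, and `g_A
= D_A f`, which is supported in `L = tsupport χ`. Let `v` be the Newtonian potential of `h = ∑_B D_B
g_B`. Since `h = -Δ f` near `L` and `D_A` commutes with `Δ`, one has `D_A h = -Δ g_A`; dividing by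
`4π²|ξ|²` on the Fourier side gives `D_A v = g_A` (`exists_potential`,
`exists_solution_tendsto_zero`). For `2n ≥ 3` the symbol is integrable, and `v` tends to zero by
Riemann–Lebesgue. Then `U = f - v` is monogenic on `Ω`.

The second vector variable forces `v` to vanish (`exists_eventuallyEq_zero`). A slice `x_1 = const`
far from `L` misses `L`, so there `v` solves `D_0 v = 0` on a whole `ℝ^n` and decays; Liouville
gives `v = 0`. Following a ray from infinity back to its last point in `L`, unique continuation
gives `v = 0` near some point of `Ω \ L`. There `U = u`, and connectedness of `Ω \ K` spreads the
equality (`exists_extension`).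

Solutions are only assumed differentiable. All their regularity is drawn from one property,
`MeanValueOn`: invariance under averaging against a radial bump. It yields smoothness, gradient
bounds, Liouville's theorem and, through Cauchy estimates, unique continuation. -/

namespace Hartogs

/-! ### Divergence theorem without continuity of the derivatives -/

section Divergence

variable {ι F : Type} [Fintype ι] [NormedAddCommGroup F] [NormedSpace ℝ F]

/-- A coordinate system identifying `EuclideanSpace ℝ ι` with `Fin (k + 1) → ℝ`. -/
noncomputable def coordEquiv {k : ℕ} (e : ι ≃ Fin (k + 1)) :
    EuclideanSpace ℝ ι ≃L[ℝ] (Fin (k + 1) → ℝ) :=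
  (LinearIsometryEquiv.piLpCongrLeft 2 ℝ ℝ e).toContinuousLinearEquiv.trans
    (EuclideanSpace.equiv (Fin (k + 1)) ℝ)

theorem coordEquiv_apply {k : ℕ} (e : ι ≃ Fin (k + 1)) (x : EuclideanSpace ℝ ι)
    (i : Fin (k + 1)) : coordEquiv e x i = x (e.symm i) := rfl

theorem coordEquiv_symm_apply {k : ℕ} (e : ι ≃ Fin (k + 1)) (x : Fin (k + 1) → ℝ) (i : ι) :
    (coordEquiv e).symm x i = x (e i) := by
  have := coordEquiv_apply e ((coordEquiv e).symm x) (e i)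
  simpa using this.symm

theorem measurePreserving_coordEquiv {k : ℕ} (e : ι ≃ Fin (k + 1)) :
    MeasurePreserving (coordEquiv e) := by
  have h1 := (LinearIsometryEquiv.piLpCongrLeft 2 ℝ ℝ e).measurePreserving
  have h2 := PiLp.volume_preserving_ofLp (Fin (k + 1))
  exact h2.comp h1

/-- The divergence of a differentiable vector field with bounded support integrates to zero, as
soon as it is integrable. -/
theorem integral_divergence_eq_zero [DecidableEq ι] [Nonempty ι] (f : ι → EuclideanSpace ℝ ι → F)
    (f' : ι → EuclideanSpace ℝ ι → EuclideanSpace ℝ ι →L[ℝ] F)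
    (hf : ∀ i x, HasFDerivAt (f i) (f' i x) x) {R : ℝ} (hR : 0 ≤ R)
    (hsupp : ∀ i x, R < ‖x‖ → f i x = 0)
    (hint : Integrable fun x => ∑ i, f' i x (EuclideanSpace.single i 1)) :
    ∫ x, ∑ i, f' i x (EuclideanSpace.single i 1) = 0 := by
  obtain ⟨k, hk⟩ : ∃ k, Fintype.card ι = k + 1 :=
    ⟨Fintype.card ι - 1, (Nat.succ_pred_eq_of_pos Fintype.card_pos).symm⟩
  let e : ι ≃ Fin (k + 1) := (Fintype.equivFin ι).trans (finCongr hk)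
  let L := coordEquiv e
  have hL := measurePreserving_coordEquiv e
  have hLe : MeasurableEmbedding L := L.toHomeomorph.measurableEmbedding
  have hLs : MeasurePreserving L.symm := by
    exact hL.symm L.toHomeomorph.toMeasurableEquiv
  have hLse : MeasurableEmbedding L.symm := L.symm.toHomeomorph.measurableEmbedding
  have hnorm : ∀ (x : Fin (k + 1) → ℝ) i, |x i| ≤ ‖L.symm x‖ := fun x i => by
    have h := PiLp.norm_apply_le (L.symm x) (e.symm i)
    rw [coordEquiv_symm_apply] at h
    simpa using h
  have hsingle : ∀ i, L.symm (Pi.single (e i) 1) = EuclideanSpace.single i 1 := fun i => by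
    ext j
    rw [coordEquiv_symm_apply]
    simp [Pi.single_apply]
  let D : EuclideanSpace ℝ ι → F := fun x => ∑ i, f' i x (EuclideanSpace.single i 1)
  have hD0 : ∀ x, R < ‖x‖ → D x = 0 := fun x hx => by
    refine Finset.sum_eq_zero fun i _ => ?_
    have h0 : f i =ᶠ[𝓝 x] fun _ => 0 := by
      filter_upwards [(isOpen_lt continuous_const continuous_norm).mem_nhds hx] with y hy
      exact hsupp i y hy
    have : f' i x = 0 := (hf i x).unique ((hasFDerivAt_const 0 x).congr_of_eventuallyEq h0)
    simp [this]
  -- The box is strictly larger than the support, so every face integral is zero.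
  let a : Fin (k + 1) → ℝ := fun _ => -(R + 1)
  let b : Fin (k + 1) → ℝ := fun _ => R + 1
  -- Only the divergence itself has to be integrable, not the individual partial derivatives. This
  -- is what admits solutions that are merely differentiable.
  have key := integral_divergence_of_hasFDerivAt_off_countable' a b
    (fun i => by simp only [a, b]; linarith)
    (fun i x => f (e.symm i) (L.symm x))
    (fun i x => (f' (e.symm i) (L.symm x)).comp (L.symm : (Fin (k + 1) → ℝ) →L[ℝ] _))
    ∅ countable_empty
    (fun i x _ => ((hf _ _).comp x L.symm.hasFDerivAt).continuousAt.continuousWithinAt)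
    (fun x _ i => (hf _ _).comp x L.symm.hasFDerivAt)
  have hsum : ∀ x : Fin (k + 1) → ℝ, ∑ i, ((f' (e.symm i) (L.symm x)).comp
      (L.symm : (Fin (k + 1) → ℝ) →L[ℝ] _)) (Pi.single i 1) = D (L.symm x) := fun x => by
    simp only [D]
    rw [← e.symm.sum_comp]
    refine Finset.sum_congr rfl fun i _ => ?_
    rw [← hsingle, e.apply_symm_apply]
    rfl
  simp only [hsum] at key
  have hint' : Integrable fun x => D (L.symm x) := hLs.integrable_comp_of_integrable hint
  have key := key hint'.integrableOn
  have hfaces : ∀ (i : Fin (k + 1)) (x : Fin k → ℝ) (c : ℝ), R < |c| →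
      f (e.symm i) (L.symm (i.insertNth c x)) = 0 := fun i x c hc => by
    refine hsupp _ _ (hc.trans_le ?_)
    simpa using hnorm (i.insertNth c x) i
  have hbb : R < |R + 1| := by rw [abs_of_nonneg (by linarith)]; linarith
  have haa : R < |-(R + 1)| := by rwa [abs_neg]
  simp only [a, b, hfaces _ _ _ hbb, hfaces _ _ _ haa, integral_zero, sub_zero,
    Finset.sum_const_zero] at key
  rw [setIntegral_eq_integral_of_forall_compl_eq_zero] at key
  · rw [← key]
    exact (hLs.integral_comp hLse D).symm
  · intro x hx
    apply hD0
    by_contra! h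
    apply hx
    rw [mem_Icc, Pi.le_def, Pi.le_def]
    constructor <;> intro i <;> have := abs_le.1 ((hnorm x i).trans h) <;> linarith [this.1, this.2]

end Divergence

/-! ### Radial bumps and the weighted mean value property -/

section Bump

/-- A smooth profile that vanishes on `[1, ∞)` and is positive on `(-∞, 1)`. -/
noncomputable def bumpProfile (t : ℝ) : ℝ := Real.smoothTransition (1 - t)

theorem contDiff_bumpProfile : ContDiff ℝ (⊤ : ℕ∞) bumpProfile :=
  Real.smoothTransition.contDiff.comp (contDiff_const.sub contDiff_id)

theorem bumpProfile_eq_zero {t : ℝ} (ht : 1 ≤ t) : bumpProfile t = 0 :=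
  Real.smoothTransition.zero_of_nonpos (by linarith)

theorem bumpProfile_nonneg (t : ℝ) : 0 ≤ bumpProfile t := Real.smoothTransition.nonneg _

theorem bumpProfile_zero : bumpProfile 0 = 1 := by simp [bumpProfile]

theorem hasDerivAt_bumpProfile (t : ℝ) : HasDerivAt bumpProfile (deriv bumpProfile t) t :=
  (contDiff_bumpProfile.differentiable (by simp)).differentiableAt.hasDerivAt

theorem continuous_deriv_bumpProfile : Continuous (deriv bumpProfile) :=
  contDiff_bumpProfile.continuous_deriv (by simp)

theorem deriv_bumpProfile_eq_zero {t : ℝ} (ht : 1 < t) : deriv bumpProfile t = 0 := by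
  have : bumpProfile =ᶠ[𝓝 t] fun _ => 0 := by
    filter_upwards [Ioi_mem_nhds ht] with s hs
    exact bumpProfile_eq_zero (le_of_lt hs)
  rw [this.deriv_eq, deriv_const]

variable {E : Type} [NormedAddCommGroup E] [InnerProductSpace ℝ E]

/-- A smooth radial bump supported in the closed unit ball. -/
noncomputable def bump (y : E) : ℝ := bumpProfile (‖y‖ ^ 2)

theorem contDiff_bump : ContDiff ℝ (⊤ : ℕ∞) (bump : E → ℝ) :=
  contDiff_bumpProfile.comp (contDiff_norm_sq ℝ)

theorem bump_nonneg (y : E) : 0 ≤ bump y := bumpProfile_nonneg _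

theorem bump_eq_zero {y : E} (hy : 1 ≤ ‖y‖) : bump y = 0 :=
  bumpProfile_eq_zero (by nlinarith)

theorem bump_neg (y : E) : bump (-y) = bump y := by simp [bump]

theorem bump_zero : bump (0 : E) = 1 := by simp [bump, bumpProfile_zero]

variable [FiniteDimensional ℝ E]

theorem hasCompactSupport_bump : HasCompactSupport (bump : E → ℝ) :=
  HasCompactSupport.intro (isCompact_closedBall 0 1) fun x hx => bump_eq_zero <| by
    simpa using (not_le.1 (by simpa using hx)).le

variable [MeasurableSpace E] [BorelSpace E]

theorem integrable_bump : Integrable (bump : E → ℝ) :=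
  contDiff_bump.continuous.integrable_of_hasCompactSupport hasCompactSupport_bump

theorem integral_bump_pos : 0 < ∫ y : E, bump y :=
  contDiff_bump.continuous.integral_pos_of_hasCompactSupport_nonneg_nonzero
    hasCompactSupport_bump bump_nonneg (x := 0) (by simp [bump_zero])

variable {F : Type} [NormedAddCommGroup F] [NormedSpace ℝ F]

theorem integrable_of_continuousOn_closedBall {g : E → F} {x : E} {s : ℝ}
    (hg : ContinuousOn g (closedBall x s)) (h0 : ∀ y ∉ closedBall x s, g y = 0) :
    Integrable g :=
  (hg.integrableOn_compact (isCompact_closedBall x s)).integrable_of_forall_notMem_eq_zero h0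

/-- `w` is continuous on `V` and equal to its averages with weight `bump` over the closed balls
contained in `V`. -/
structure MeanValueOn (w : E → F) (V : Set E) : Prop where
  continuousOn : ContinuousOn w V
  integral_eq : ∀ x s, 0 < s → closedBall x s ⊆ V →
    ∫ y : E, bump y • w (x + s • y) = (∫ y : E, bump y) • w x

theorem add_smul_mem_closedBall {x y : E} {r s : ℝ} (hr : 0 ≤ r) (hrs : r ≤ s)
    (hy : y ∈ closedBall (0 : E) 1) : x + r • y ∈ closedBall x s := by
  rw [mem_closedBall_zero_iff] at hy
  rw [mem_closedBall, dist_eq_norm, add_sub_cancel_left, norm_smul, Real.norm_of_nonneg hr]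
  nlinarith [norm_nonneg y]

theorem integrable_bump_smul {w : E → F} {x : E} {s : ℝ} (hs : 0 ≤ s)
    (hw : ContinuousOn w (closedBall x s)) : Integrable fun y : E => bump y • w (x + s • y) := by
  refine integrable_of_continuousOn_closedBall (x := 0) (s := 1) ?_ fun y hy => ?_
  · refine contDiff_bump.continuous.continuousOn.smul (hw.comp (by fun_prop) fun y hy => ?_)
    exact add_smul_mem_closedBall hs le_rfl hy
  · rw [bump_eq_zero, zero_smul]
    simpa using (not_le.1 (by simpa using hy)).le

/-- The endpoint `r = 0` matters: there the average degenerates to a multiple of `w x`, which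
identifies the constant value of the averages. -/
theorem continuousOn_integral_bump_smul {w : E → F} {x : E} {s : ℝ}
    (hw : ContinuousOn w (closedBall x s)) :
    ContinuousOn (fun r : ℝ => ∫ y : E, bump y • w (x + r • y)) (Icc 0 s) := by
  obtain ⟨M, hM⟩ := (isCompact_closedBall x s).exists_bound_of_continuousOn hw
  refine continuousOn_of_dominated (bound := fun y => bump y * M) ?_ ?_ ?_ ?_
  · intro r hr
    exact (integrable_bump_smul hr.1 (hw.mono (closedBall_subset_closedBall hr.2))).1
  · intro r hr
    refine Eventually.of_forall fun y => ?_
    by_cases hy : 1 ≤ ‖y‖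
    · simp [bump_eq_zero hy]
    · rw [norm_smul, Real.norm_of_nonneg (bump_nonneg y)]
      exact mul_le_mul_of_nonneg_left (hM _ (add_smul_mem_closedBall hr.1 hr.2
        (by simpa using (not_le.1 hy).le))) (bump_nonneg y)
  · exact integrable_bump.mul_const M
  · refine Eventually.of_forall fun y => ?_
    by_cases hy : 1 ≤ ‖y‖
    · simp [bump_eq_zero hy, continuousOn_const]
    · exact continuousOn_const.smul (hw.comp (by fun_prop) fun r hr =>
        add_smul_mem_closedBall hr.1 hr.2 (by simpa using (not_le.1 hy).le))

end Bump

/-! ### Weyl's lemma: from the first order system to the mean value property -/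

section Weyl

variable {ι F : Type} [Fintype ι] [DecidableEq ι] [NormedAddCommGroup F] [NormedSpace ℝ F]

/-- The coefficients `z i * z j` are symmetric, so only the symmetric part of `B`, which is the
identity, contributes. -/
theorem sum_symm_part {B : ι → ι → F →L[ℝ] F}
    (hB : ∀ i j v, B i j v + B j i v = if i = j then (2 : ℝ) • v else 0)
    (z : EuclideanSpace ℝ ι) (v : F) : ∑ j, ∑ i, (z i * z j) • B i j v = ‖z‖ ^ 2 • v := by
  have h2 : ∑ j, ∑ i, (z i * z j) • B i j v = ∑ j, ∑ i, (z i * z j) • B j i v := by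
    rw [Finset.sum_comm]
    exact Finset.sum_congr rfl fun i _ => Finset.sum_congr rfl fun j _ => by rw [mul_comm]
  have h3 : (2 : ℝ) • ∑ j, ∑ i, (z i * z j) • B i j v = (2 : ℝ) • ‖z‖ ^ 2 • v := by
    rw [two_smul]
    nth_rw 2 [h2]
    simp only [← Finset.sum_add_distrib, ← smul_add, hB]
    simp only [smul_ite, smul_zero, Finset.sum_ite_eq', Finset.mem_univ, if_true]
    rw [← Finset.sum_smul, EuclideanSpace.real_norm_sq_eq, smul_smul, smul_smul, mul_comm]
    congr 1
    simp only [pow_two]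
  exact smul_right_injective F (two_ne_zero' ℝ) h3

variable [CompleteSpace F] {V : Set (EuclideanSpace ℝ ι)} {u : EuclideanSpace ℝ ι → F}
  {B : ι → ι → F →L[ℝ] F}

theorem hasFDerivAt_bumpProfile_norm_sq (c : ℝ) (z : EuclideanSpace ℝ ι) :
    HasFDerivAt (fun z : EuclideanSpace ℝ ι => bumpProfile (c * ‖z‖ ^ 2))
      ((deriv bumpProfile (c * ‖z‖ ^ 2) * (c * 2)) • innerSL ℝ z) z := by
  have h1 : HasFDerivAt (fun z : EuclideanSpace ℝ ι => c * ‖z‖ ^ 2) (c • 2 • innerSL ℝ z) z :=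
    (hasStrictFDerivAt_norm_sq z).hasFDerivAt.const_mul c
  have h2 := (hasDerivAt_bumpProfile (c * ‖z‖ ^ 2)).comp_hasFDerivAt z h1
  have h3 : (deriv bumpProfile (c * ‖z‖ ^ 2) * (c * 2)) • innerSL ℝ z =
      deriv bumpProfile (c * ‖z‖ ^ 2) • c • 2 • innerSL ℝ z := by module
  rw [h3]
  exact h2

/-- The divergence of the vector field `z ↦ (∑ i, p(c|z|²) z_i B_ij u(z))_j`, for a solution `u` of
`∑ j, B_ij ∂_j u = 0`. -/
theorem divergence_weighted_field
    (hB : ∀ i j v, B i j v + B j i v = if i = j then (2 : ℝ) • v else 0)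
    {z : EuclideanSpace ℝ ι} (hd : DifferentiableAt ℝ u z)
    (hu : ∀ i, ∑ j, B i j (fderiv ℝ u z (EuclideanSpace.single j 1)) = 0) (c : ℝ) :
    ∑ j, fderiv ℝ (fun z => ∑ i, (bumpProfile (c * ‖z‖ ^ 2) * z i) • B i j (u z)) z
      (EuclideanSpace.single j 1) =
    (Fintype.card ι * bumpProfile (c * ‖z‖ ^ 2) +
      2 * (c * ‖z‖ ^ 2 * deriv bumpProfile (c * ‖z‖ ^ 2))) • u z := by
  set p := bumpProfile (c * ‖z‖ ^ 2)
  set p' := deriv bumpProfile (c * ‖z‖ ^ 2)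
  have h1 : ∀ i j, HasFDerivAt (fun z => (bumpProfile (c * ‖z‖ ^ 2) * z i) • B i j (u z)) _ z :=
    fun i j => ((hasFDerivAt_bumpProfile_norm_sq c z).mul
      (EuclideanSpace.proj (𝕜 := ℝ) i).hasFDerivAt).smul
        ((B i j).hasFDerivAt.comp z hd.hasFDerivAt)
  have h2 : ∀ j, fderiv ℝ (fun z => ∑ i, (bumpProfile (c * ‖z‖ ^ 2) * z i) • B i j (u z)) z
      (EuclideanSpace.single j 1) =
      ∑ i, ((p * z i) • B i j (fderiv ℝ u z (EuclideanSpace.single j 1)) +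
        (p * (if i = j then 1 else 0)) • B i j (u z) +
        (p' * (c * 2)) • (z i * z j) • B i j (u z)) := fun j => by
    rw [(HasFDerivAt.fun_sum fun i _ => h1 i j).fderiv]
    rw [sum_apply]
    refine Finset.sum_congr rfl fun i _ => ?_
    by_cases hij : i = j <;> simp [hij, p, p', EuclideanSpace.inner_single_right] <;> module
  have hdiag : ∀ i v, B i i v = v := fun i v => by
    have := hB i i v
    rw [if_pos rfl, ← two_smul ℝ] at this
    exact smul_right_injective F (two_ne_zero' ℝ) this
  simp only [h2, Finset.sum_add_distrib]
  -- With the sum over `j` inside, the terms containing derivatives of `u` assemble into the system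
  -- and disappear; what remains is a continuous multiple of `u`.
  rw [Finset.sum_comm]
  simp only [← Finset.smul_sum, hu, smul_zero, Finset.sum_const_zero, zero_add]
  rw [sum_symm_part hB]
  simp only [mul_ite, mul_one, mul_zero, ite_smul, zero_smul, Finset.sum_ite_eq', Finset.mem_univ,
    if_true, hdiag, Finset.sum_const, Finset.card_univ, ← Nat.cast_smul_eq_nsmul ℝ]
  module

/-- Weak form of `∑ j, B_ij ∂_j u = 0`, tested against a radial function. -/
theorem integral_weighted_eq_zero [Nonempty ι]
    (hB : ∀ i j v, B i j v + B j i v = if i = j then (2 : ℝ) • v else 0) {s : ℝ} (hs : 0 < s)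
    (hd : ∀ z ∈ closedBall 0 s, DifferentiableAt ℝ u z)
    (hu : ∀ z ∈ closedBall 0 s, ∀ i,
      ∑ j, B i j (fderiv ℝ u z (EuclideanSpace.single j 1)) = 0)
    {c : ℝ} (hc : 1 < c * s ^ 2) :
    ∫ z : EuclideanSpace ℝ ι, (Fintype.card ι * bumpProfile (c * ‖z‖ ^ 2) +
      2 * (c * ‖z‖ ^ 2 * deriv bumpProfile (c * ‖z‖ ^ 2))) • u z = 0 := by
  have hc0 : 0 < c := by
    by_contra! h
    nlinarith [sq_nonneg s]
  have hout : ∀ z : EuclideanSpace ℝ ι, z ∉ closedBall 0 s → 1 < c * ‖z‖ ^ 2 := fun z hz => by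
    rw [mem_closedBall_zero_iff, not_le] at hz
    have : s ^ 2 ≤ ‖z‖ ^ 2 := by gcongr
    nlinarith
  let f : ι → EuclideanSpace ℝ ι → F := fun j z =>
    ∑ i, (bumpProfile (c * ‖z‖ ^ 2) * z i) • B i j (u z)
  have hzero : ∀ z : EuclideanSpace ℝ ι, z ∉ closedBall 0 s → ∀ j, f j z = 0 := fun z hz j => by
    simp [f, bumpProfile_eq_zero (hout z hz).le]
  have hzero' : ∀ z : EuclideanSpace ℝ ι, z ∉ closedBall 0 s → ∀ j, f j =ᶠ[𝓝 z] fun _ => 0 :=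
    fun z hz j => by
      filter_upwards [isClosed_closedBall.isOpen_compl.mem_nhds hz] with y hy
      exact hzero y hy j
  have hdiv : ∀ z, ∑ j, fderiv ℝ (f j) z (EuclideanSpace.single j 1) =
      (Fintype.card ι * bumpProfile (c * ‖z‖ ^ 2) +
      2 * (c * ‖z‖ ^ 2 * deriv bumpProfile (c * ‖z‖ ^ 2))) • u z := fun z => by
    by_cases hz : z ∈ closedBall 0 s
    · exact divergence_weighted_field hB (hd z hz) (hu z hz) c
    · simp [(hzero' z hz _).fderiv_eq, bumpProfile_eq_zero (hout z hz).le,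
        deriv_bumpProfile_eq_zero (hout z hz)]
  have hint : Integrable fun z : EuclideanSpace ℝ ι =>
      (Fintype.card ι * bumpProfile (c * ‖z‖ ^ 2) +
      2 * (c * ‖z‖ ^ 2 * deriv bumpProfile (c * ‖z‖ ^ 2))) • u z := by
    refine integrable_of_continuousOn_closedBall (x := 0) (s := s) ?_ fun z hz => ?_
    · refine ContinuousOn.smul (Continuous.continuousOn ?_)
        fun z hz => (hd z hz).continuousAt.continuousWithinAt
      have h1 := contDiff_bumpProfile.continuous
      have h2 := continuous_deriv_bumpProfile
      fun_prop
    · simp [bumpProfile_eq_zero (hout z hz).le, deriv_bumpProfile_eq_zero (hout z hz)]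
  -- Integrability of the divergence is read off from its expression in `u` alone, although `fderiv
  -- ℝ u` may be unbounded.
  simp only [← hdiv] at hint ⊢
  refine integral_divergence_eq_zero f (fun j => fderiv ℝ (f j)) (fun j z => ?_) hs.le
    (fun j z hz => hzero z (by simpa using hz) j) hint
  refine DifferentiableAt.hasFDerivAt ?_
  by_cases hz : z ∈ closedBall 0 s
  · refine DifferentiableAt.fun_sum fun i _ => DifferentiableAt.fun_smul ?_ ?_
    · exact (hasFDerivAt_bumpProfile_norm_sq c z).differentiableAt.mul
        (EuclideanSpace.proj (𝕜 := ℝ) i).differentiableAt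
    · exact (B i j).differentiableAt.comp z (hd z hz)
  · exact (differentiableAt_const 0).congr_of_eventuallyEq (hzero' z hz j)

/-- The radius enters only through the smooth profile, so continuity of `u` is enough to
differentiate under the integral. -/
theorem hasDerivAt_integral_scaled_bump {s r : ℝ} (hr : 0 < r) (hrs : r < s)
    (hw : ContinuousOn u (closedBall 0 s)) :
    HasDerivAt (fun r : ℝ => ∫ z, bumpProfile ((r ^ 2)⁻¹ * ‖z‖ ^ 2) • u z)
      (∫ z, (-2 / r * ((r ^ 2)⁻¹ * ‖z‖ ^ 2 * deriv bumpProfile ((r ^ 2)⁻¹ * ‖z‖ ^ 2))) • u z) r := by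
  have hcb := contDiff_bumpProfile.continuous
  have hcb' := continuous_deriv_bumpProfile
  have hs : 0 < s := hr.trans hrs
  have hout : ∀ ρ, 0 < ρ → ρ < s → ∀ z : EuclideanSpace ℝ ι, z ∉ closedBall 0 s →
      1 < (ρ ^ 2)⁻¹ * ‖z‖ ^ 2 := fun ρ h0 h1 z hz => by
    rw [mem_closedBall_zero_iff, not_le] at hz
    rw [inv_mul_eq_div, one_lt_div (by positivity)]
    exact pow_lt_pow_left₀ (h1.trans hz) h0.le (by norm_num)
  -- The radii stay away from `0`, where `G` is singular, and below `s`, so that the bump stays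
  -- supported in the ball.
  have hnhds : Ioo (r / 2) s ∈ 𝓝 r := Ioo_mem_nhds (by linarith) hrs
  let G : ℝ × EuclideanSpace ℝ ι → F := fun q =>
    (-2 / q.1 * ((q.1 ^ 2)⁻¹ * ‖q.2‖ ^ 2 * deriv bumpProfile ((q.1 ^ 2)⁻¹ * ‖q.2‖ ^ 2))) • u q.2
  have hG : ContinuousOn G (Icc (r / 2) s ×ˢ closedBall 0 s) := by
    have hne : ∀ q ∈ Icc (r / 2) s ×ˢ closedBall (0 : EuclideanSpace ℝ ι) s, q.1 ≠ 0 :=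
      fun q hq => by have := hq.1.1; intro h; linarith
    refine ContinuousOn.smul ?_ (hw.comp continuousOn_snd fun q hq => hq.2)
    have h1 : ContinuousOn (fun q : ℝ × EuclideanSpace ℝ ι => (q.1 ^ 2)⁻¹ * ‖q.2‖ ^ 2)
        (Icc (r / 2) s ×ˢ closedBall 0 s) :=
      ContinuousOn.mul (ContinuousOn.inv₀ (by fun_prop) fun q hq => pow_ne_zero 2 (hne q hq))
        (by fun_prop)
    exact (continuousOn_const.div continuousOn_fst hne).mul
      (h1.mul (hcb'.comp_continuousOn h1))
  obtain ⟨M, hM⟩ := (isCompact_Icc.prod (isCompact_closedBall 0 s)).exists_bound_of_continuousOn hG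
  refine (hasDerivAt_integral_of_dominated_loc_of_deriv_le (𝕜 := ℝ) (E := F)
    (F := fun r z => bumpProfile ((r ^ 2)⁻¹ * ‖z‖ ^ 2) • u z) (F' := fun r z => G (r, z))
    (bound := (closedBall 0 s).indicator fun _ => M) hnhds ?_ ?_ ?_ ?_ ?_ ?_).2
  · filter_upwards [hnhds] with ρ hρ
    have hρ0 : 0 < ρ := by linarith [hρ.1]
    refine (integrable_of_continuousOn_closedBall (x := 0) (s := s) ?_ fun z hz => ?_).1
    · exact ContinuousOn.smul (by fun_prop) hw
    · rw [bumpProfile_eq_zero (hout ρ hρ0 hρ.2 z hz).le, zero_smul]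
  · refine integrable_of_continuousOn_closedBall (x := 0) (s := s) ?_ fun z hz => ?_
    · exact ContinuousOn.smul (by fun_prop) hw
    · rw [bumpProfile_eq_zero (hout r hr hrs z hz).le, zero_smul]
  · refine (integrable_of_continuousOn_closedBall (x := 0) (s := s) ?_ fun z hz => ?_).1
    · exact hG.comp (by fun_prop) fun z hz => ⟨⟨by linarith, hrs.le⟩, hz⟩
    · simp [G, deriv_bumpProfile_eq_zero (hout r hr hrs z hz)]
  · refine Eventually.of_forall fun z ρ hρ => ?_
    have hρ0 : 0 < ρ := by linarith [hρ.1]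
    by_cases hz : z ∈ closedBall 0 s
    · rw [indicator_of_mem hz]
      exact hM (ρ, z) ⟨⟨hρ.1.le, hρ.2.le⟩, hz⟩
    · simp [G, deriv_bumpProfile_eq_zero (hout ρ hρ0 hρ.2 z hz), hz]
  · exact (integrable_indicator_iff measurableSet_closedBall).2
      (integrableOn_const (isCompact_closedBall (0 : EuclideanSpace ℝ ι) s).measure_lt_top.ne)
  · refine Eventually.of_forall fun z ρ hρ => ?_
    have hρ0 : 0 < ρ := by linarith [hρ.1]
    have h1 : HasDerivAt (fun ρ : ℝ => (ρ ^ 2)⁻¹ * ‖z‖ ^ 2)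
        (-(2 * ρ) / (ρ ^ 2) ^ 2 * ‖z‖ ^ 2) ρ := by
      have := ((hasDerivAt_pow 2 ρ).fun_inv (pow_ne_zero 2 hρ0.ne')).mul_const (‖z‖ ^ 2)
      simpa using this
    have h2 := ((hasDerivAt_bumpProfile ((ρ ^ 2)⁻¹ * ‖z‖ ^ 2)).comp ρ h1).smul_const (u z)
    refine h2.congr_deriv ?_
    simp only [G]
    congr 1
    field_simp

/-- The substitution `z = r • y` moves the dilation from `u` to the bump. -/
theorem integral_bump_smul_scaled {r : ℝ} (hr : 0 < r) :
    ∫ y, bump y • u (r • y) = (r ^ Fintype.card ι)⁻¹ •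
      ∫ z : EuclideanSpace ℝ ι, bumpProfile ((r ^ 2)⁻¹ * ‖z‖ ^ 2) • u z := by
  have h := Measure.integral_comp_smul (volume : Measure (EuclideanSpace ℝ ι))
    (fun z => bumpProfile ((r ^ 2)⁻¹ * ‖z‖ ^ 2) • u z) r
  rw [finrank_euclideanSpace, abs_of_pos (by positivity)] at h
  rw [← h]
  congr 1
  ext y
  rw [norm_smul, Real.norm_of_nonneg hr.le, mul_pow, inv_mul_cancel_left₀ (by positivity)]
  rfl

/-- The averages `I r` do not depend on the radius: up to a factor, `I' r` is the integral that
`integral_weighted_eq_zero` annihilates. Letting `r` tend to `0` gives the value at the centre. -/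
theorem integral_bump_eq_of_closedBall [Nonempty ι]
    (hB : ∀ i j v, B i j v + B j i v = if i = j then (2 : ℝ) • v else 0) {s : ℝ} (hs : 0 < s)
    (hd : ∀ z ∈ closedBall 0 s, DifferentiableAt ℝ u z)
    (hu : ∀ z ∈ closedBall 0 s, ∀ i,
      ∑ j, B i j (fderiv ℝ u z (EuclideanSpace.single j 1)) = 0) :
    ∫ y : EuclideanSpace ℝ ι, bump y • u (s • y) =
      (∫ y : EuclideanSpace ℝ ι, bump y) • u 0 := by
  have hw : ContinuousOn u (closedBall 0 s) :=
    fun z hz => (hd z hz).continuousAt.continuousWithinAt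
  let I : ℝ → F := fun r => ∫ y, bump y • u (r • y)
  have hI : ContinuousOn I (Icc 0 s) := by
    simpa [I] using continuousOn_integral_bump_smul hw
  have hI' : ∀ r ∈ Ioo 0 s, HasDerivAt I 0 r := fun r hr => by
    have h1 := hasDerivAt_integral_scaled_bump hr.1 hr.2 hw
    have hc : 1 < (r ^ 2)⁻¹ * s ^ 2 := by
      rw [inv_mul_eq_div, one_lt_div (pow_pos hr.1 2)]
      exact pow_lt_pow_left₀ hr.2 hr.1.le (by norm_num)
    have h2 := integral_weighted_eq_zero hB hs hd hu hc
    have h3 : HasDerivAt (fun r : ℝ => (r ^ Fintype.card ι)⁻¹)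
        (-(Fintype.card ι / r) * (r ^ Fintype.card ι)⁻¹) r := by
      have := (hasDerivAt_pow (Fintype.card ι) r).fun_inv (pow_ne_zero _ hr.1.ne')
      refine this.congr_deriv ?_
      have := hr.1.ne'
      obtain ⟨k, hk⟩ : ∃ k, Fintype.card ι = k + 1 :=
        ⟨Fintype.card ι - 1, (Nat.succ_pred_eq_of_pos Fintype.card_pos).symm⟩
      rw [hk, Nat.add_sub_cancel]
      field_simp
      ring
    have h4 := h3.fun_smul h1
    have h5 : HasDerivAt I _ r := h4.congr_of_eventuallyEq (by
      filter_upwards [Ioi_mem_nhds hr.1] with ρ hρ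
      exact integral_bump_smul_scaled hρ)
    convert h5 using 1
    have hint : ∀ q : ℝ → ℝ, Continuous q → (∀ t, 1 < t → q t = 0) →
        Integrable fun z : EuclideanSpace ℝ ι => q ((r ^ 2)⁻¹ * ‖z‖ ^ 2) • u z := by
      intro q hq hq0
      refine integrable_of_continuousOn_closedBall (x := 0) (s := s)
        (ContinuousOn.smul (by fun_prop) hw) fun z hz => ?_
      rw [mem_closedBall_zero_iff, not_le] at hz
      rw [hq0, zero_smul]
      refine hc.trans ?_
      have := hr.1
      gcongr
    have hint1 := hint bumpProfile contDiff_bumpProfile.continuous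
      fun t ht => bumpProfile_eq_zero ht.le
    have hint2 := hint (fun t => t * deriv bumpProfile t)
      (continuous_id.mul continuous_deriv_bumpProfile)
      fun t ht => by rw [deriv_bumpProfile_eq_zero ht, mul_zero]
    have h6 : (Fintype.card ι : ℝ) • (∫ z, bumpProfile ((r ^ 2)⁻¹ * ‖z‖ ^ 2) • u z) +
        (2 : ℝ) • ∫ z, ((r ^ 2)⁻¹ * ‖z‖ ^ 2 * deriv bumpProfile ((r ^ 2)⁻¹ * ‖z‖ ^ 2)) • u z = 0 := by
      have h7 := integral_add (hint1.smul (Fintype.card ι : ℝ)) (hint2.smul (2 : ℝ))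
      simp only [Pi.smul_apply, integral_smul] at h7
      rw [← h2, ← h7]
      congr 1
      ext z
      module
    have h7 : (∫ z, (-2 / r * ((r ^ 2)⁻¹ * ‖z‖ ^ 2 *
        deriv bumpProfile ((r ^ 2)⁻¹ * ‖z‖ ^ 2))) • u z) = (-2 / r) •
        ∫ z, ((r ^ 2)⁻¹ * ‖z‖ ^ 2 * deriv bumpProfile ((r ^ 2)⁻¹ * ‖z‖ ^ 2)) • u z := by
      rw [← integral_smul]
      simp only [smul_smul]
    rw [h7]
    set J1 := ∫ z : EuclideanSpace ℝ ι, bumpProfile ((r ^ 2)⁻¹ * ‖z‖ ^ 2) • u z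
    -- With `d` the dimension, `J1` the integral of `p(t) u` and `J2` that of `t p'(t) u`, where `t
    -- = |z|² / r²`, the derivative of `r⁻ᵈ J1` is `-r⁻ᵈ⁻¹ (d J1 + 2 J2)`.
    linear_combination (norm := module) ((r ^ Fintype.card ι)⁻¹ / r) • h6
  have hconst : ∀ r ∈ Ioo 0 s, I r = I s := fun r hr => by
    refine (constant_of_has_deriv_right_zero (a := r) (b := s)
      (hI.mono (Icc_subset_Icc hr.1.le le_rfl)) (fun t ht => ?_) s (right_mem_Icc.2 hr.2.le)).symm
    exact (hI' t ⟨hr.1.trans_le ht.1, ht.2⟩).hasDerivWithinAt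
  have hlim : Tendsto I (𝓝[Ioo 0 s] 0) (𝓝 (I 0)) :=
    ((hI 0 (left_mem_Icc.2 hs.le)).mono Ioo_subset_Icc_self)
  have hlim' : Tendsto I (𝓝[Ioo 0 s] 0) (𝓝 (I s)) :=
    tendsto_const_nhds.congr' (by
      filter_upwards [self_mem_nhdsWithin] with r hr
      exact (hconst r hr).symm)
  have : (𝓝[Ioo 0 s] (0 : ℝ)).NeBot := left_nhdsWithin_Ioo_neBot hs
  have := tendsto_nhds_unique hlim' hlim
  simp only [I, zero_smul] at this
  rw [this, integral_smul_const]

/-- Weyl's lemma: merely differentiable solutions of a first order system `∑ j, B_ij ∂_j u = 0`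
with `B_ij + B_ji = 2δ_ij` have the mean value property. -/
theorem meanValueOn_of_system [Nonempty ι]
    (hB : ∀ i j v, B i j v + B j i v = if i = j then (2 : ℝ) • v else 0)
    (hd : ∀ z ∈ V, DifferentiableAt ℝ u z)
    (hu : ∀ z ∈ V, ∀ i, ∑ j, B i j (fderiv ℝ u z (EuclideanSpace.single j 1)) = 0) :
    MeanValueOn u V where
  continuousOn z hz := (hd z hz).continuousAt.continuousWithinAt
  integral_eq x s hs hsV := by
    have hmem : ∀ z ∈ closedBall (0 : EuclideanSpace ℝ ι) s, x + z ∈ V := fun z hz =>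
      hsV (by simpa [dist_eq_norm] using hz)
    have := integral_bump_eq_of_closedBall (u := fun z => u (x + z)) hB hs
      (fun z hz => (hd _ (hmem z hz)).comp z (by fun_prop))
      (fun z hz i => by simpa only [fderiv_comp_add_left] using hu _ (hmem z hz) i)
    simpa using this

end Weyl

/-! ### Smoothness, gradient estimate and Liouville's theorem from the mean value property -/

section MeanValue

variable {E F : Type} [NormedAddCommGroup E] [InnerProductSpace ℝ E] [FiniteDimensional ℝ E]
  [MeasurableSpace E] [BorelSpace E] [NormedAddCommGroup F] [NormedSpace ℝ F] {w : E → F}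
  {V : Set E}

theorem exists_closedBall_add_subset {x : E} {s : ℝ} (hV : IsOpen V) (h : closedBall x s ⊆ V)
    (hs : 0 ≤ s) : ∃ δ > 0, closedBall x (s + δ) ⊆ V := by
  obtain ⟨δ, hδ, h'⟩ := (isCompact_closedBall x s).exists_cthickening_subset_open hV h
  refine ⟨δ, hδ, ?_⟩
  rwa [cthickening_closedBall hδ.le hs, add_comm] at h'

theorem MeanValueOn.comp_affine (hw : MeanValueOn w V) (a : E) {r : ℝ} (hr : 0 < r) :
    MeanValueOn (fun y => w (a + r • y)) ((fun y => a + r • y) ⁻¹' V) where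
  continuousOn := hw.continuousOn.comp (by fun_prop) fun _ hx => hx
  integral_eq x s hs hsV := by
    have h := hw.integral_eq (a + r • x) (r * s) (by positivity) fun z hz => by
      have : z = a + r • (r⁻¹ • (z - a)) := by
        rw [smul_inv_smul₀ hr.ne', add_sub_cancel]
      rw [this]
      refine hsV ?_
      rw [mem_closedBall, dist_eq_norm] at hz ⊢
      have h2 : r⁻¹ • (z - a) - x = r⁻¹ • (z - (a + r • x)) := by
        rw [← sub_sub, smul_sub r⁻¹ (z - a), inv_smul_smul₀ hr.ne']
      rw [h2, norm_smul, norm_inv, Real.norm_of_nonneg hr.le, inv_mul_le_iff₀ hr]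
      exact hz
    rw [← h]
    simp only [smul_add, smul_smul, add_assoc]

/-- The bump is even, so the averages over unit balls form a convolution, in which derivatives can
be put on the bump. Truncating `w` makes it locally integrable on the whole space and is invisible
for `‖x‖ ≤ δ`. -/
theorem MeanValueOn.eq_convolution (hw : MeanValueOn w V) {δ : ℝ}
    (hδV : closedBall 0 (1 + δ) ⊆ V) {x : E} (hx : ‖x‖ ≤ δ) :
    w x = (∫ y : E, bump y)⁻¹ • (convolution (bump : E → ℝ)
      ((closedBall 0 (1 + δ)).indicator w) (ContinuousLinearMap.lsmul ℝ ℝ) volume) x := by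
  have h1 := hw.integral_eq x 1 one_pos fun z hz => hδV (by
    rw [mem_closedBall, dist_eq_norm] at hz
    rw [mem_closedBall_zero_iff]
    calc ‖z‖ = ‖(z - x) + x‖ := by rw [sub_add_cancel]
      _ ≤ 1 + δ := (norm_add_le _ _).trans (add_le_add hz hx))
  rw [eq_inv_smul_iff₀ integral_bump_pos.ne', ← h1, convolution_def, ← integral_neg_eq_self]
  congr 1
  ext y
  simp only [ContinuousLinearMap.lsmul_apply, one_smul, bump_neg, ← sub_eq_add_neg]
  by_cases hy : 1 ≤ ‖y‖
  · simp [bump_eq_zero hy]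
  · rw [indicator_of_mem]
    rw [mem_closedBall_zero_iff]
    exact (norm_sub_le _ _).trans (by linarith)

theorem locallyIntegrable_indicator (hw : ContinuousOn w V) {r : ℝ} (h : closedBall 0 r ⊆ V) :
    LocallyIntegrable ((closedBall (0 : E) r).indicator w) :=
  ((integrable_indicator_iff measurableSet_closedBall).2
    ((hw.mono h).integrableOn_compact (isCompact_closedBall 0 r))).locallyIntegrable

theorem MeanValueOn.contDiffAt_zero (hw : MeanValueOn w V) {δ : ℝ} (hδ : 0 < δ)
    (hδV : closedBall 0 (1 + δ) ⊆ V) : ContDiffAt ℝ (⊤ : ℕ∞) w 0 := by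
  have h := (hasCompactSupport_bump (E := E)).contDiff_convolution_left (μ := volume)
    (ContinuousLinearMap.lsmul ℝ ℝ) contDiff_bump
    (locallyIntegrable_indicator hw.continuousOn hδV)
  refine (h.const_smul (∫ y : E, bump y)⁻¹).contDiffAt.congr_of_eventuallyEq ?_
  filter_upwards [ball_mem_nhds 0 hδ] with x hx
  exact hw.eq_convolution hδV (by simpa using (mem_ball.1 hx).le)

/-- The constant in the gradient estimate. -/
noncomputable def gradConst (E : Type) [NormedAddCommGroup E] [InnerProductSpace ℝ E]
    [FiniteDimensional ℝ E] [MeasurableSpace E] [BorelSpace E] : ℝ :=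
  (∫ y : E, bump y)⁻¹ * ∫ y : E, ‖fderiv ℝ (bump : E → ℝ) y‖

theorem gradConst_nonneg : 0 ≤ gradConst E :=
  mul_nonneg (inv_nonneg.2 integral_bump_pos.le) (integral_nonneg fun _ => norm_nonneg _)

/-- The derivative falls on the bump, which leaves its `L¹` norm times the supremum of `w`. The
margin `δ` only serves to have the convolution formula in a neighbourhood of `0`. -/
theorem MeanValueOn.norm_fderiv_zero_le (hw : MeanValueOn w V) {δ : ℝ} (hδ : 0 < δ)
    (hδV : closedBall 0 (1 + δ) ⊆ V) {M : ℝ} (hM : ∀ x ∈ closedBall 0 1, ‖w x‖ ≤ M) :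
    ‖fderiv ℝ w 0‖ ≤ gradConst E * M := by
  have hloc := locallyIntegrable_indicator hw.continuousOn hδV
  have h := ((hasCompactSupport_bump (E := E)).hasFDerivAt_convolution_left (μ := volume)
    (ContinuousLinearMap.lsmul ℝ ℝ) (contDiff_bump.of_le (by simp)) hloc 0).const_smul
      (∫ y : E, bump y)⁻¹
  have h' : HasFDerivAt w _ 0 := h.congr_of_eventuallyEq (by
    filter_upwards [ball_mem_nhds 0 hδ] with x hx
    exact hw.eq_convolution hδV (by simpa using (mem_ball.1 hx).le))
  have hc : Continuous (fderiv ℝ (bump : E → ℝ)) := contDiff_bump.continuous_fderiv (by simp)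
  have hint : Integrable fun y : E => ‖fderiv ℝ (bump : E → ℝ) y‖ :=
    (hc.integrable_of_hasCompactSupport (hasCompactSupport_bump.fderiv ℝ)).norm
  rw [h'.fderiv, norm_smul, norm_inv, Real.norm_of_nonneg integral_bump_pos.le, gradConst,
    mul_assoc]
  refine mul_le_mul_of_nonneg_left ?_ (inv_nonneg.2 integral_bump_pos.le)
  rw [convolution_def, ← integral_mul_const]
  refine norm_integral_le_of_norm_le (hint.mul_const M) (Eventually.of_forall fun y => ?_)
  by_cases hy : y ∈ closedBall (0 : E) 1
  · refine ContinuousLinearMap.opNorm_le_bound _ (mul_nonneg (norm_nonneg _)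
      ((norm_nonneg _).trans (hM y hy))) fun e => ?_
    rw [ContinuousLinearMap.precompL_apply, ContinuousLinearMap.lsmul_apply, norm_smul, mul_right_comm]
    have hy' : 0 - y ∈ closedBall (0 : E) 1 := by simpa using hy
    rw [indicator_of_mem (closedBall_subset_closedBall (by linarith) hy')]
    gcongr
    · exact ContinuousLinearMap.le_opNorm _ _
    · exact hM _ hy'
  · have : fderiv ℝ (bump : E → ℝ) y = 0 := by
      have h0 : (bump : E → ℝ) =ᶠ[𝓝 y] fun _ => 0 := by
        filter_upwards [isClosed_closedBall.isOpen_compl.mem_nhds hy] with z hz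
        refine bump_eq_zero ?_
        simpa using (not_le.1 (by simpa using hz)).le
      simp [h0.fderiv_eq]
    simp [this]

theorem MeanValueOn.contDiffOn (hw : MeanValueOn w V) (hV : IsOpen V) :
    ContDiffOn ℝ (⊤ : ℕ∞) w V := by
  intro x hx
  obtain ⟨r, hr, hrV⟩ := nhds_basis_closedBall.mem_iff.1 (hV.mem_nhds hx)
  have h := (hw.comp_affine x (half_pos hr)).contDiffAt_zero one_pos fun y hy => hrV (by
    rw [mem_closedBall_zero_iff] at hy
    rw [mem_closedBall, dist_eq_norm, add_sub_cancel_left, norm_smul,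
      Real.norm_of_nonneg (half_pos hr).le]
    nlinarith)
  have h2 : w = (fun y => w (x + (r / 2) • y)) ∘ fun z => (r / 2)⁻¹ • (z - x) := by
    ext z
    rw [comp_apply, smul_inv_smul₀ (half_pos hr).ne', add_sub_cancel]
  rw [h2]
  refine ContDiffAt.contDiffWithinAt (ContDiffAt.comp x ?_ (by fun_prop))
  simpa using h

theorem MeanValueOn.norm_fderiv_le (hw : MeanValueOn w V) (hV : IsOpen V) {x : E} {s : ℝ}
    (hs : 0 < s) (hsV : closedBall x s ⊆ V) {M : ℝ} (hM : ∀ y ∈ closedBall x s, ‖w y‖ ≤ M) :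
    ‖fderiv ℝ w x‖ ≤ gradConst E / s * M := by
  obtain ⟨δ, hδ, hδV⟩ := exists_closedBall_add_subset hV hsV hs.le
  have h := (hw.comp_affine x hs).norm_fderiv_zero_le (div_pos hδ hs) (fun y hy => hδV (by
    rw [mem_closedBall_zero_iff] at hy
    rw [mem_closedBall, dist_eq_norm, add_sub_cancel_left, norm_smul, Real.norm_of_nonneg hs.le]
    calc s * ‖y‖ ≤ s * (1 + δ / s) := by gcongr
      _ = s + δ := by field_simp)) (fun y hy => hM _ (add_smul_mem_closedBall hs.le le_rfl hy))
  have hd : HasFDerivAt w (fderiv ℝ w x) x :=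
    (((hw.contDiffOn hV).contDiffAt (hV.mem_nhds (hsV (mem_closedBall_self hs.le)))).differentiableAt
      (by simp)).hasFDerivAt
  have h2 : HasFDerivAt (fun y => w (x + s • y)) (s • fderiv ℝ w x) 0 := by
    have h3 : HasFDerivAt (fun y : E => x + s • y) (s • ContinuousLinearMap.id ℝ E) 0 :=
      ((hasFDerivAt_id (𝕜 := ℝ) (0 : E)).const_smul s).const_add x
    have h4 : HasFDerivAt w (fderiv ℝ w x) (x + s • (0 : E)) := by simpa using hd
    have := h4.comp 0 h3
    rwa [ContinuousLinearMap.comp_smul, ContinuousLinearMap.comp_id] at this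
  rw [h2.fderiv, norm_smul, Real.norm_of_nonneg hs.le] at h
  rw [div_mul_eq_mul_div, le_div_iff₀ hs, mul_comm]
  exact h

/-- Differentiate the mean value identity with respect to the centre of the ball. The property thus
passes to all iterated derivatives. -/
theorem MeanValueOn.fderiv_apply [CompleteSpace F] (hw : MeanValueOn w V) (hV : IsOpen V) (e : E) :
    MeanValueOn (fun x => fderiv ℝ w x e) V := by
  have hC := hw.contDiffOn hV
  have hc : ContinuousOn (fderiv ℝ w) V := hC.continuousOn_fderiv_of_isOpen hV (by simp)
  refine ⟨hc.clm_apply continuousOn_const, fun x s hs hsV => ?_⟩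
  obtain ⟨δ, hδ, hδV⟩ := exists_closedBall_add_subset hV hsV hs.le
  obtain ⟨M, hM⟩ := (isCompact_closedBall x (s + δ)).exists_bound_of_continuousOn (hc.mono hδV)
  have hsub : ∀ x' ∈ ball x δ, closedBall x' s ⊆ closedBall x (s + δ) := fun x' hx' =>
    closedBall_subset_closedBall' (by linarith [(mem_ball.1 hx').le])
  have hint : Integrable fun y : E => bump y • fderiv ℝ w (x + s • y) :=
    integrable_bump_smul hs.le (hc.mono hsV)
  have h1 : HasFDerivAt (fun x' => ∫ y : E, bump y • w (x' + s • y))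
      (∫ y : E, bump y • fderiv ℝ w (x + s • y)) x := by
    refine hasFDerivAt_integral_of_dominated_of_fderiv_le (𝕜 := ℝ)
      (F' := fun x' y => bump y • fderiv ℝ w (x' + s • y)) (bound := fun y => bump y * M)
      (ball_mem_nhds x hδ) ?_ ?_ ?_ ?_ ?_ ?_
    · filter_upwards [ball_mem_nhds x hδ] with x' hx'
      exact (integrable_bump_smul hs.le (hw.continuousOn.mono ((hsub x' hx').trans hδV))).1
    · exact integrable_bump_smul hs.le (hw.continuousOn.mono hsV)
    · exact hint.1
    · refine Eventually.of_forall fun y x' hx' => ?_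
      rw [norm_smul, Real.norm_of_nonneg (bump_nonneg y)]
      by_cases hy : 1 ≤ ‖y‖
      · simp [bump_eq_zero hy]
      · exact mul_le_mul_of_nonneg_left (hM _ (hsub x' hx' (add_smul_mem_closedBall hs.le le_rfl
          (by simpa using (not_le.1 hy).le)))) (bump_nonneg y)
    · exact integrable_bump.mul_const M
    · refine Eventually.of_forall fun y x' hx' => ?_
      by_cases hy : 1 ≤ ‖y‖
      · simpa [bump_eq_zero hy] using hasFDerivAt_const (0 : F) x'
      · have hmem : x' + s • y ∈ V := hδV (hsub x' hx' (add_smul_mem_closedBall hs.le le_rfl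
          (by simpa using (not_le.1 hy).le)))
        have hd : HasFDerivAt w (fderiv ℝ w (x' + s • y)) (x' + s • y) :=
          ((hC.contDiffAt (hV.mem_nhds hmem)).differentiableAt (by simp)).hasFDerivAt
        have := (hd.comp x' ((hasFDerivAt_id (𝕜 := ℝ) x').add_const (s • y))).const_smul (bump y)
        rwa [ContinuousLinearMap.comp_id] at this
  have h2 : HasFDerivAt (fun x' => (∫ y : E, bump y) • w x')
      (∫ y : E, bump y • fderiv ℝ w (x + s • y)) x := h1.congr_of_eventuallyEq (by
    filter_upwards [ball_mem_nhds x hδ] with x' hx'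
    exact (hw.integral_eq x' s hs ((hsub x' hx').trans hδV)).symm)
  have h3 := (((hC.contDiffAt (hV.mem_nhds (hsV (mem_closedBall_self hs.le)))).differentiableAt
      (by simp)).hasFDerivAt.const_smul (∫ y : E, bump y)).unique h2
  have h4 := DFunLike.congr_fun h3 e
  rw [ContinuousLinearMap.integral_apply hint] at h4
  exact h4.symm

/-- A function that tends to zero at infinity and has the mean value property vanishes. -/
theorem MeanValueOn.eq_zero_of_tendsto [Nontrivial E] [CompleteSpace F] (hw : MeanValueOn w univ)
    (h0 : Tendsto w (cocompact E) (𝓝 0)) (x : E) : w x = 0 := by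
  have hc : Continuous w := continuousOn_univ.1 hw.continuousOn
  obtain ⟨M, hM⟩ : ∃ M, ∀ y, ‖w y‖ ≤ M := by
    have h1 : ∀ᶠ y in cocompact E, ‖w y‖ ≤ 1 :=
      (h0.norm.eventually_lt_const (by simp)).mono fun y hy => le_of_lt hy
    obtain ⟨t, ht, h2⟩ := mem_cocompact.1 h1
    obtain ⟨M, hM⟩ := ht.exists_bound_of_continuousOn hc.continuousOn
    refine ⟨max M 1, fun y => ?_⟩
    by_cases hy : y ∈ t
    · exact (hM y hy).trans (le_max_left _ _)
    · exact (h2 hy).trans (le_max_right _ _)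
  -- The averages over balls of growing radius are all equal to a multiple of `w x`. They tend to
  -- zero by dominated convergence, because `x + (n + 1) y` leaves every compact set when `y ≠ 0`.
  have h1 : Tendsto (fun n : ℕ => ∫ y : E, bump y • w (x + (n + 1 : ℝ) • y)) atTop
      (𝓝 (∫ _ : E, (0 : F))) := by
    refine tendsto_integral_of_dominated_convergence (fun y => bump y * M) (fun n => ?_)
      (integrable_bump.mul_const M) (fun n => Eventually.of_forall fun y => ?_) ?_
    · have := contDiff_bump (E := E).continuous
      exact Continuous.aestronglyMeasurable (by fun_prop)
    · rw [norm_smul, Real.norm_of_nonneg (bump_nonneg y)]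
      exact mul_le_mul_of_nonneg_left (hM _) (bump_nonneg y)
    · have hne : ∀ᵐ y : E, y ≠ 0 := by
        simp [ae_iff]
      filter_upwards [hne] with y hy
      rw [← smul_zero (bump y)]
      refine (h0.comp ?_).const_smul (bump y)
      rw [← cobounded_eq_cocompact, ← tendsto_norm_atTop_iff_cobounded]
      refine tendsto_atTop_mono (f := fun n : ℕ => (n + 1 : ℝ) * ‖y‖ - ‖x‖) (fun n => ?_) ?_
      · have h2 := norm_sub_norm_le ((n + 1 : ℝ) • y) (-x)
        rw [norm_neg, sub_neg_eq_add, add_comm _ x, norm_smul, Real.norm_of_nonneg (by positivity)]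
          at h2
        exact h2
      · refine tendsto_atTop_add_const_right _ _ (Tendsto.atTop_mul_const (norm_pos_iff.2 hy) ?_)
        exact tendsto_atTop_add_const_right _ _ tendsto_natCast_atTop_atTop
  have h3 : ∀ n : ℕ, ∫ y : E, bump y • w (x + (n + 1 : ℝ) • y) = (∫ y : E, bump y) • w x :=
    fun n => hw.integral_eq x _ (by positivity) (subset_univ _)
  simp only [h3, integral_zero] at h1
  have h2 := tendsto_nhds_unique h1 tendsto_const_nhds
  exact (smul_eq_zero.1 h2.symm).resolve_left integral_bump_pos.ne'

end MeanValue

/-! ### Cauchy estimates and unique continuation -/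

section UniqueContinuation

variable {E F : Type} [NormedAddCommGroup E] [InnerProductSpace ℝ E] [FiniteDimensional ℝ E]
  [MeasurableSpace E] [BorelSpace E] [NormedAddCommGroup F] [NormedSpace ℝ F] {w : E → F}
  {V : Set E}

/-- Taylor's bound for a function whose derivatives all vanish at `0`, obtained by integrating `K`
times. -/
theorem norm_le_of_iterated_deriv_zero {f : ℕ → ℝ → F}
    (hf : ∀ k, ∀ t ∈ Icc (0 : ℝ) 1, HasDerivAt (f k) (f (k + 1) t) t) (h0 : ∀ k, f k 0 = 0)
    (K : ℕ) {B : ℝ} (hB : ∀ t ∈ Icc (0 : ℝ) 1, ‖f K t‖ ≤ B) :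
    ∀ t ∈ Icc (0 : ℝ) 1, ‖f 0 t‖ ≤ B * (t ^ K / K.factorial) := by
  induction K generalizing f with
  | zero => intro t ht; simpa using hB t ht
  | succ K ih =>
    have h1 := ih (f := fun k => f (k + 1)) (fun k => hf (k + 1)) (fun k => h0 (k + 1)) hB
    refine image_norm_le_of_norm_deriv_right_le_deriv_boundary (f' := f 1)
      (B' := fun t => B * (t ^ K / K.factorial))
      (fun t ht => (hf 0 t ht).continuousAt.continuousWithinAt)
      (fun t ht => (hf 0 t ⟨ht.1, ht.2.le⟩).hasDerivWithinAt) (by simp [h0]) (fun t => ?_)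
      (fun t ht => h1 t ⟨ht.1, ht.2.le⟩)
    refine (((hasDerivAt_pow (K + 1) t).div_const _).const_mul B).congr_deriv ?_
    rw [Nat.factorial_succ]
    push_cast
    have : (K.factorial : ℝ) ≠ 0 := by positivity
    field_simp

/-- The `k`-th derivative of `w` in direction `e`. -/
noncomputable def dirDeriv (w : E → F) (e : E) (k : ℕ) : E → F :=
  (fun (g : E → F) x => fderiv ℝ g x e)^[k] w

theorem dirDeriv_succ (w : E → F) (e : E) (k : ℕ) :
    dirDeriv w e (k + 1) = fun x => fderiv ℝ (dirDeriv w e k) x e :=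
  iterate_succ_apply' _ _ _

theorem MeanValueOn.dirDeriv [CompleteSpace F] (hw : MeanValueOn w V) (hV : IsOpen V) (e : E)
    (k : ℕ) : MeanValueOn (dirDeriv w e k) V := by
  induction k with
  | zero => exact hw
  | succ k ih => rw [dirDeriv_succ]; exact ih.fderiv_apply hV e

theorem dirDeriv_eventuallyEq_zero {p : E} (h : w =ᶠ[𝓝 p] 0) (e : E) (k : ℕ) :
    dirDeriv w e k =ᶠ[𝓝 p] 0 := by
  induction k with
  | zero => exact h
  | succ k ih =>
    rw [dirDeriv_succ]
    filter_upwards [ih.fderiv (𝕜 := ℝ)] with x hx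
    simp [hx]

/-- Cauchy estimates. -/
theorem MeanValueOn.norm_dirDeriv_le [CompleteSpace F] (hw : MeanValueOn w V) (hV : IsOpen V)
    {p : E} {R δ M : ℝ} (hδ : 0 < δ) (hR : closedBall p R ⊆ V) (e : E)
    (hM : ∀ x ∈ closedBall p R, ‖w x‖ ≤ M) (j : ℕ) :
    ∀ x ∈ closedBall p (R - j * δ), ‖Hartogs.dirDeriv w e j x‖ ≤
      M * (gradConst E * ‖e‖ / δ) ^ j := by
  induction j with
  | zero => intro x hx; simpa [Hartogs.dirDeriv] using hM x (by simpa using hx)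
  | succ j ih =>
    intro x hx
    -- Each derivative is paid for by shrinking the radius by `δ`.
    have hsub : closedBall x δ ⊆ closedBall p (R - j * δ) :=
      closedBall_subset_closedBall' (by
        have := mem_closedBall.1 hx
        push_cast at this
        linarith)
    have hsub' : closedBall p (R - j * δ) ⊆ closedBall p R :=
      closedBall_subset_closedBall (by have : 0 ≤ j * δ := by positivity
                                       linarith)
    have h := (hw.dirDeriv hV e j).norm_fderiv_le hV hδ (hsub.trans (hsub'.trans hR))
      fun y hy => ih y (hsub hy)
    rw [dirDeriv_succ]
    calc ‖fderiv ℝ (Hartogs.dirDeriv w e j) x e‖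
        ≤ gradConst E / δ * (M * (gradConst E * ‖e‖ / δ) ^ j) * ‖e‖ :=
          ContinuousLinearMap.le_of_opNorm_le _ h e
      _ = _ := by rw [pow_succ]; ring

/-- The relative radius on which vanishing propagates. -/
noncomputable def propRadius (E : Type) [NormedAddCommGroup E] [InnerProductSpace ℝ E]
    [FiniteDimensional ℝ E] [MeasurableSpace E] [BorelSpace E] : ℝ :=
  (2 * gradConst E * Real.exp 1 + 2)⁻¹

theorem propRadius_pos : 0 < propRadius E := by
  have := gradConst_nonneg (E := E)
  unfold propRadius
  positivity

theorem propRadius_le : propRadius E ≤ 1 / 2 := by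
  have := gradConst_nonneg (E := E)
  rw [propRadius, ← one_div]
  have : 0 ≤ 2 * gradConst E * Real.exp 1 := by positivity
  exact one_div_le_one_div_of_le two_pos (by linarith)

/-- All derivatives vanish at `p`. Taylor's bound of order `K` along the segment to `x`, the Cauchy
estimates and `K^K / K! ≤ e^K` give `‖w x‖ ≤ M q^K`; `propRadius` is chosen to make `q < 1`. -/
theorem MeanValueOn.eq_zero_of_mem_ball [CompleteSpace F] (hw : MeanValueOn w V) (hV : IsOpen V)
    {p : E} {R : ℝ} (hR0 : 0 < R) (hR : closedBall p R ⊆ V) (h0 : w =ᶠ[𝓝 p] 0) {x : E}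
    (hx : x ∈ ball p (propRadius E * R)) : w x = 0 := by
  obtain ⟨M, hM⟩ := (isCompact_closedBall p R).exists_bound_of_continuousOn
    (hw.continuousOn.mono hR)
  have hC := gradConst_nonneg (E := E)
  have hM0 : 0 ≤ M := (norm_nonneg _).trans (hM p (mem_closedBall_self hR0.le))
  set e := x - p with he
  have hxe : ‖e‖ < propRadius E * R := by rwa [mem_ball, dist_eq_norm] at hx
  have heR : ‖e‖ ≤ R / 2 := by
    have := mul_le_mul_of_nonneg_right (propRadius_le (E := E)) hR0.le
    linarith
  set q := 2 * gradConst E * Real.exp 1 * ‖e‖ / R with hq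
  have hq0 : 0 ≤ q := by positivity
  have hq1 : q < 1 := by
    rw [hq, div_lt_one hR0]
    have h1 : (2 * gradConst E * Real.exp 1 + 2) * ‖e‖ < R := by
      rw [propRadius, inv_mul_eq_div, lt_div_iff₀ (by positivity)] at hxe
      linarith
    nlinarith [norm_nonneg e]
  have hbound : ∀ K : ℕ, 0 < K → ‖w x‖ ≤ M * q ^ K := fun K hK => by
    have hK' : (0 : ℝ) < K := Nat.cast_pos.2 hK
    -- With steps of length `R / (2K)`, the `K` derivatives use up half of the radius; the segment
    -- lies in the remaining half.
    have hδ : 0 < R / (2 * K) := by positivity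
    have hseg : ∀ t ∈ Icc (0 : ℝ) 1, p + t • e ∈ closedBall p (R - K * (R / (2 * K))) := by
      intro t ht
      have h2 : R - K * (R / (2 * K)) = R / 2 := by field_simp; ring
      rw [h2, mem_closedBall, dist_eq_norm, add_sub_cancel_left, norm_smul,
        Real.norm_of_nonneg ht.1]
      nlinarith [norm_nonneg e, ht.2]
    have hsegV : ∀ t ∈ Icc (0 : ℝ) 1, p + t • e ∈ V := fun t ht => hR
      (closedBall_subset_closedBall (by
        have : 0 ≤ K * (R / (2 * K)) := by positivity
        linarith) (hseg t ht))
    have h1 := norm_le_of_iterated_deriv_zero (f := fun k t => Hartogs.dirDeriv w e k (p + t • e))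
      (fun k t ht => ?_) (fun k => ?_) K
      (fun t ht => hw.norm_dirDeriv_le hV hδ hR e hM K _ (hseg t ht)) 1 (by simp)
    · have h2 : p + (1 : ℝ) • e = x := by rw [one_smul, he, add_sub_cancel]
      simp only [h2, one_pow] at h1
      calc ‖w x‖ ≤ M * (gradConst E * ‖e‖ / (R / (2 * K))) ^ K * (1 / K.factorial) := h1
        _ = M * (2 * gradConst E * ‖e‖ / R) ^ K * ((K : ℝ) ^ K / K.factorial) := by
            have : gradConst E * ‖e‖ / (R / (2 * K)) = (2 * gradConst E * ‖e‖ / R) * K := by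
              field_simp
            rw [this, mul_pow]
            ring
        _ ≤ M * (2 * gradConst E * ‖e‖ / R) ^ K * Real.exp 1 ^ K := by
            gcongr
            rw [← Real.exp_nat_mul, mul_one]
            exact Real.pow_div_factorial_le_exp _ hK'.le _
        _ = M * q ^ K := by
            rw [mul_assoc, ← mul_pow, hq]
            congr 2
            ring
    · have hd : HasFDerivAt (Hartogs.dirDeriv w e k) (fderiv ℝ (Hartogs.dirDeriv w e k) (p + t • e))
          (p + t • e) :=
        ((((hw.dirDeriv hV e k).contDiffOn hV).contDiffAt
          (hV.mem_nhds (hsegV t ht))).differentiableAt (by simp)).hasFDerivAt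
      have hl : HasDerivAt (fun t : ℝ => p + t • e) e t := by
        simpa using ((hasDerivAt_id t).smul_const e).const_add p
      have := hd.comp_hasDerivAt t hl
      simp only [dirDeriv_succ]
      exact this
    · simpa using (dirDeriv_eventuallyEq_zero h0 e k).self_of_nhds
  have hlim : Tendsto (fun K : ℕ => M * q ^ K) atTop (𝓝 (M * 0)) :=
    (tendsto_pow_atTop_nhds_zero_of_lt_one hq0 hq1).const_mul M
  rw [mul_zero] at hlim
  have := ge_of_tendsto hlim ((eventually_gt_atTop 0).mono hbound)
  exact norm_le_zero_iff.1 this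

/-- Unique continuation. -/
theorem MeanValueOn.eventuallyEq_zero_of_isPreconnected [CompleteSpace F] (hw : MeanValueOn w V)
    (hV : IsOpen V) {S : Set E} (hS : IsPreconnected S) (hSV : S ⊆ V) {p : E} (hp : p ∈ S)
    (h0 : w =ᶠ[𝓝 p] 0) : ∀ x ∈ S, w =ᶠ[𝓝 x] 0 := by
  -- The set of points near which `w` vanishes is open. It is closed in `S` because the radius of
  -- propagation is a fixed fraction of the radius of a ball inside `V`.
  refine hS.subset_of_closure_inter_subset (u := {x | w =ᶠ[𝓝 x] 0}) isOpen_setOfPred_eventually_nhds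
    ⟨p, hp, h0⟩ ?_
  rintro x ⟨hx, hxS⟩
  obtain ⟨r, hr, hrV⟩ := nhds_basis_closedBall.mem_iff.1 (hV.mem_nhds (hSV hxS))
  have hpos := propRadius_pos (E := E)
  have hhalf := propRadius_le (E := E)
  obtain ⟨a, ha, hax⟩ := mem_closure_iff.1 hx (propRadius E * (r / 2)) (by positivity)
  have hsub : closedBall a (r / 2) ⊆ V :=
    (closedBall_subset_closedBall' (by rw [dist_comm]; nlinarith)).trans hrV
  filter_upwards [isOpen_ball.mem_nhds (mem_ball.2 hax)] with y hy
  exact hw.eq_zero_of_mem_ball hV (half_pos hr) hsub ha hy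

end UniqueContinuation

/-! ### The Newtonian potential on the Fourier side -/

section Potential

variable {E F : Type} [NormedAddCommGroup E] [InnerProductSpace ℝ E] [FiniteDimensional ℝ E]
  [MeasurableSpace E] [BorelSpace E] [NormedAddCommGroup F] [NormedSpace ℂ F]

/-- In polar coordinates the integrand becomes `r ^ (d - 3)`; this is where dimension at least `3`
is needed. -/
theorem integrableOn_inv_norm_sq (hE : 3 ≤ Module.finrank ℝ E) :
    IntegrableOn (fun ξ : E => (‖ξ‖ ^ 2)⁻¹) (ball 0 1) := by
  have : Nontrivial E := Module.nontrivial_of_finrank_pos (R := ℝ) (by omega)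
  rw [integrableOn_fun_norm_addHaar volume (f := fun r => (r ^ 2)⁻¹)]
  have h1 : IntegrableOn (fun y : ℝ => y ^ (Module.finrank ℝ E - 3)) (Ioo 0 1) :=
    ((continuous_pow _).continuousOn.integrableOn_Icc (a := 0) (b := 1)).mono_set Ioo_subset_Icc_self
  refine h1.congr_fun (fun y hy => ?_) measurableSet_Ioo
  have : Module.finrank ℝ E - 1 = (Module.finrank ℝ E - 3) + 2 := by omega
  have hy0 := hy.1.ne'
  simp only [this, smul_eq_mul, pow_add]
  field_simp

/-- A Schwartz function multiplied by a function with a singularity `O(‖ξ‖⁻²)` at the origin. -/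
theorem integrable_of_norm_le_inv_norm_sq (hE : 3 ≤ Module.finrank ℝ E) (f : 𝓢(E, F)) {m : E → F}
    (hm : AEStronglyMeasurable m) {C : ℝ} (hC : 0 ≤ C)
    (h1 : ∀ ξ, ‖ξ‖ < 1 → ‖m ξ‖ ≤ C * (‖ξ‖ ^ 2)⁻¹ * ‖f ξ‖) (h2 : ∀ ξ, 1 ≤ ‖ξ‖ → ‖m ξ‖ ≤ C * ‖f ξ‖) :
    Integrable m := by
  obtain ⟨M, hM⟩ := (isCompact_closedBall (0 : E) 1).exists_bound_of_continuousOn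
    f.continuous.continuousOn
  have hi : Integrable ((ball (0 : E) 1).indicator fun ξ => C * (‖ξ‖ ^ 2)⁻¹ * M) :=
    (integrable_indicator_iff measurableSet_ball).2
      (((integrableOn_inv_norm_sq hE).const_mul C).mul_const M)
  have hM0 : 0 ≤ M := (norm_nonneg _).trans (hM 0 (mem_closedBall_self zero_le_one))
  refine (hi.add (f.integrable.norm.const_mul C)).mono' hm (Eventually.of_forall fun ξ => ?_)
  simp only [Pi.add_apply]
  by_cases hξ : ‖ξ‖ < 1
  · rw [indicator_of_mem (by simpa using hξ)]
    have h3 : ‖m ξ‖ ≤ C * (‖ξ‖ ^ 2)⁻¹ * M := (h1 ξ hξ).trans (by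
      gcongr
      exact hM ξ (by simpa using hξ.le))
    have : 0 ≤ C * ‖f ξ‖ := by positivity
    linarith
  · rw [indicator_of_notMem (by simpa using hξ), zero_add]
    exact h2 ξ (not_lt.1 hξ)

theorem fourierInv_fderiv_apply (f : 𝓢(E, F)) (e ξ : E) :
    𝓕⁻ (fun x => fderiv ℝ f x e) ξ =
      (-(2 * Real.pi * Complex.I) * (inner ℝ ξ e : ℝ)) • 𝓕⁻ (f : E → F) ξ := by
  have h := DFunLike.congr_fun (SchwartzMap.fourierInv_lineDerivOp_eq f e) ξ
  have ht : (inner ℝ · e : E → ℝ).HasTemperateGrowth := by fun_prop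
  rw [smul_apply, SchwartzMap.smulLeftCLM_apply_apply ht] at h
  rw [mul_smul, Complex.coe_smul, ← SchwartzMap.fourierInv_coe, ← h, SchwartzMap.fourierInv_coe]
  rfl

theorem fourierInv_sum_clm {ι : Type} [Fintype ι] [CompleteSpace F] (c : ι → F →L[ℂ] F)
    {f : ι → E → F} (hf : ∀ i, Integrable (f i)) (ξ : E) :
    𝓕⁻ (fun x => ∑ i, c i (f i x)) ξ = ∑ i, c i (𝓕⁻ (f i) ξ) := by
  have hi : ∀ i, Integrable fun v => Real.fourierChar (inner ℝ v ξ) • f i v := fun i => by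
    have := (Real.fourierIntegral_convergent_iff (-ξ)).2 (hf i)
    simpa using this
  simp only [Real.fourierInv_eq]
  simp only [← ContinuousLinearMap.integral_comp_comm _ (hi _)]
  rw [← integral_finsetSum]
  · congr 1
    ext v
    rw [Finset.smul_sum]
    refine Finset.sum_congr rfl fun i _ => ?_
    rw [Circle.smul_def, Circle.smul_def, map_smul]
  · exact fun i _ => (c i).integrable_comp (hi i)

theorem fourier_sum_clm {ι : Type} [Fintype ι] [CompleteSpace F] (c : ι → F →L[ℂ] F)
    {f : ι → E → F} (hf : ∀ i, Integrable (f i)) (x : E) :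
    𝓕 (fun x => ∑ i, c i (f i x)) x = ∑ i, c i (𝓕 (f i) x) := by
  have := fourierInv_sum_clm c hf (-x)
  simpa only [Real.fourierInv_eq_fourier_neg, neg_neg] using this

/-- The Fourier transform of the Newtonian potential. -/
noncomputable def potentialSymbol (h : E → F) (ξ : E) : F :=
  (((2 * Real.pi) ^ 2 * ‖ξ‖ ^ 2 : ℝ) : ℂ)⁻¹ • 𝓕⁻ h ξ

theorem aestronglyMeasurable_potentialSymbol (h : 𝓢(E, F)) :
    AEStronglyMeasurable (potentialSymbol (h : E → F)) := by
  refine AEStronglyMeasurable.smul (Measurable.aestronglyMeasurable (by fun_prop)) ?_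
  rw [← SchwartzMap.fourierInv_coe]
  exact (𝓕⁻ h : 𝓢(E, F)).continuous.aestronglyMeasurable

theorem norm_potentialSymbol (h : E → F) (ξ : E) :
    ‖potentialSymbol h ξ‖ = ((2 * Real.pi) ^ 2)⁻¹ * (‖ξ‖ ^ 2)⁻¹ * ‖𝓕⁻ h ξ‖ := by
  rw [potentialSymbol, norm_smul, norm_inv, Complex.norm_real,
    Real.norm_of_nonneg (by positivity), mul_inv]

theorem integrable_potentialSymbol (hE : 3 ≤ Module.finrank ℝ E) (h : 𝓢(E, F)) :
    Integrable (potentialSymbol (h : E → F)) := by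
  refine integrable_of_norm_le_inv_norm_sq hE (𝓕⁻ h) (aestronglyMeasurable_potentialSymbol h)
    (C := ((2 * Real.pi) ^ 2)⁻¹) (by positivity) (fun ξ hξ => ?_) (fun ξ hξ => ?_)
  · rw [norm_potentialSymbol, ← SchwartzMap.fourierInv_coe]
  · rw [norm_potentialSymbol, ← SchwartzMap.fourierInv_coe]
    have : (‖ξ‖ ^ 2)⁻¹ ≤ 1 := inv_le_one_of_one_le₀ (one_le_pow₀ hξ)
    calc _ ≤ ((2 * Real.pi) ^ 2)⁻¹ * 1 * ‖(𝓕⁻ h : 𝓢(E, F)) ξ‖ := by gcongr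
      _ = _ := by rw [mul_one]

/-- This first moment makes the potential differentiable under the Fourier integral. -/
theorem integrable_norm_mul_potentialSymbol (hE : 3 ≤ Module.finrank ℝ E) (h : 𝓢(E, F)) :
    Integrable fun ξ => ‖ξ‖ * ‖potentialSymbol (h : E → F) ξ‖ := by
  have h1 : Integrable fun ξ => ‖ξ‖ • potentialSymbol (h : E → F) ξ := by
    refine integrable_of_norm_le_inv_norm_sq hE (𝓕⁻ h)
      (continuous_norm.aestronglyMeasurable.smul (aestronglyMeasurable_potentialSymbol h))
      (C := ((2 * Real.pi) ^ 2)⁻¹) (by positivity) (fun ξ hξ => ?_) (fun ξ hξ => ?_)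
    · rw [norm_smul, norm_norm, norm_potentialSymbol, ← SchwartzMap.fourierInv_coe]
      refine mul_le_of_le_one_left ?_ hξ.le
      positivity
    · rw [norm_smul, norm_norm, norm_potentialSymbol, ← SchwartzMap.fourierInv_coe]
      have h2 : ‖ξ‖ * (‖ξ‖ ^ 2)⁻¹ ≤ 1 := by
        have h0 : ‖ξ‖ ≠ 0 := by linarith
        have : ‖ξ‖ * (‖ξ‖ ^ 2)⁻¹ = ‖ξ‖⁻¹ := by field_simp
        rw [this]
        exact inv_le_one_of_one_le₀ hξ
      calc _ = ((2 * Real.pi) ^ 2)⁻¹ * (‖ξ‖ * (‖ξ‖ ^ 2)⁻¹) * ‖(𝓕⁻ h : 𝓢(E, F)) ξ‖ := by ring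
        _ ≤ ((2 * Real.pi) ^ 2)⁻¹ * 1 * ‖(𝓕⁻ h : 𝓢(E, F)) ξ‖ := by gcongr
        _ = _ := by rw [mul_one]
  simpa [norm_smul] using h1.norm

theorem fderiv_fourier_potentialSymbol [CompleteSpace F] (hE : 3 ≤ Module.finrank ℝ E)
    (h : 𝓢(E, F)) (x e : E) :
    Integrable (fun ξ : E => (-(2 * Real.pi * Complex.I) * (inner ℝ ξ e : ℝ)) •
        potentialSymbol (h : E → F) ξ) ∧
    fderiv ℝ (𝓕 (potentialSymbol (h : E → F))) x e =
      𝓕 (fun ξ : E => (-(2 * Real.pi * Complex.I) * (inner ℝ ξ e : ℝ)) •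
        potentialSymbol (h : E → F) ξ) x := by
  have hm := integrable_potentialSymbol hE h
  have hm' := integrable_norm_mul_potentialSymbol hE h
  have hint : Integrable (VectorFourier.fourierSMulRight (innerSL ℝ)
      (potentialSymbol (h : E → F))) := by
    refine (hm'.const_mul (2 * Real.pi * ‖(innerSL ℝ : E →L[ℝ] E →L[ℝ] ℝ)‖)).mono'
      hm.1.fourierSMulRight (Eventually.of_forall fun ξ => ?_)
    refine (VectorFourier.norm_fourierSMulRight_le _ _ _).trans (le_of_eq ?_)
    ring
  have heq : (fun ξ => VectorFourier.fourierSMulRight (innerSL ℝ)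
      (potentialSymbol (h : E → F)) ξ e) = fun ξ : E =>
      (-(2 * Real.pi * Complex.I) * (inner ℝ ξ e : ℝ)) • potentialSymbol (h : E → F) ξ := by
    ext ξ
    rw [VectorFourier.fourierSMulRight_apply, mul_smul, Complex.coe_smul]
    rfl
  rw [← heq]
  refine ⟨hint.apply_continuousLinearMap e, ?_⟩
  rw [Real.fderiv_fourier hm hm', Real.fourier_continuousLinearMap_apply hint]

end Potential

/-! ### Solving first order equations by the potential -/

section PotentialSystem

variable {ι F : Type} [Fintype ι] [DecidableEq ι] [NormedAddCommGroup F] [NormedSpace ℂ F]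
  [CompleteSpace F]

/-- The Newtonian potential `v` of a test function `h` (so that `-Δ v = h`). -/
theorem exists_potential (hι : 3 ≤ Fintype.card ι) {h : EuclideanSpace ℝ ι → F}
    (hc : HasCompactSupport h) (hs : ContDiff ℝ ∞ h) :
    ∃ v : EuclideanSpace ℝ ι → F, Differentiable ℝ v ∧ Tendsto v (cocompact _) (𝓝 0) ∧
      ∀ (c : ι → F →L[ℂ] F) (g : EuclideanSpace ℝ ι → F), HasCompactSupport g → ContDiff ℝ ∞ g →
      (∀ x, ∑ i, c i (fderiv ℝ h x (EuclideanSpace.single i 1)) =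
        -∑ i, fderiv ℝ (fun y => fderiv ℝ g y (EuclideanSpace.single i 1)) x
          (EuclideanSpace.single i 1)) →
      ∀ x, ∑ i, c i (fderiv ℝ v x (EuclideanSpace.single i 1)) = g x := by
  have hE : 3 ≤ Module.finrank ℝ (EuclideanSpace ℝ ι) := by rwa [finrank_euclideanSpace]
  let H : 𝓢(EuclideanSpace ℝ ι, F) := hc.toSchwartzMap hs
  have hm := integrable_potentialSymbol hE H
  have hm' := integrable_norm_mul_potentialSymbol hE H
  -- The decay at infinity is the Riemann–Lebesgue lemma.
  refine ⟨𝓕 (potentialSymbol h), Real.differentiable_fourier hm hm',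
    tendsto_integral_exp_inner_smul_cocompact _, fun c g hgc hgs hg x => ?_⟩
  let G : 𝓢(EuclideanSpace ℝ ι, F) := hgc.toSchwartzMap hgs
  let e : ι → EuclideanSpace ℝ ι := fun i => EuclideanSpace.single i 1
  have hnorm : ∀ ξ : EuclideanSpace ℝ ι, ∑ i, (inner ℝ ξ (e i) : ℝ) ^ 2 = ‖ξ‖ ^ 2 := fun ξ => by
    rw [EuclideanSpace.real_norm_sq_eq]
    simp [e, EuclideanSpace.inner_single_right]
  -- This is the relation `∑ c_i ∂_i h = -Δ g` after the inverse Fourier transform; division by the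
  -- scalar on the right turns `h` into the symbol of `v`.
  have hsymb : ∀ ξ : EuclideanSpace ℝ ι,
      ∑ i, c i ((-(2 * Real.pi * Complex.I) * (inner ℝ ξ (e i) : ℝ)) • 𝓕⁻ h ξ) =
      (((2 * Real.pi) ^ 2 * ‖ξ‖ ^ 2 : ℝ) : ℂ) • 𝓕⁻ g ξ := fun ξ => by
    have h1 := fourierInv_sum_clm c (f := fun i y => fderiv ℝ h y (e i))
      (fun i => (∂_{e i} H : 𝓢(EuclideanSpace ℝ ι, F)).integrable) ξ
    have h2 := fourierInv_sum_clm (fun _ : ι => -ContinuousLinearMap.id ℂ F)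
      (f := fun i y => fderiv ℝ (fun z => fderiv ℝ g z (e i)) y (e i))
      (fun i => (∂_{e i} (∂_{e i} G) : 𝓢(EuclideanSpace ℝ ι, F)).integrable) ξ
    have h3 : (fun y => ∑ i, c i (fderiv ℝ h y (e i))) = fun y => ∑ i : ι,
        (-ContinuousLinearMap.id ℂ F) (fderiv ℝ (fun z => fderiv ℝ g z (e i)) y (e i)) := by
      ext y
      simpa using hg y
    rw [h3, h2] at h1
    have h4 : ∀ i, 𝓕⁻ (fun y => fderiv ℝ h y (e i)) ξ =
        (-(2 * Real.pi * Complex.I) * (inner ℝ ξ (e i) : ℝ)) • 𝓕⁻ h ξ :=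
      fun i => fourierInv_fderiv_apply H (e i) ξ
    have h5 : ∀ i, 𝓕⁻ (fun y => fderiv ℝ (fun z => fderiv ℝ g z (e i)) y (e i)) ξ =
        (-(2 * Real.pi * Complex.I) * (inner ℝ ξ (e i) : ℝ)) •
        (-(2 * Real.pi * Complex.I) * (inner ℝ ξ (e i) : ℝ)) • 𝓕⁻ g ξ := fun i => by
      have h6 := fourierInv_fderiv_apply (∂_{e i} G : 𝓢(EuclideanSpace ℝ ι, F)) (e i) ξ
      have h7 := fourierInv_fderiv_apply G (e i) ξ
      exact h6.trans (congrArg _ h7)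
    simp only [h4, h5] at h1
    rw [← h1]
    simp only [neg_apply, ContinuousLinearMap.id_apply, smul_smul, ← neg_smul]
    rw [← Finset.sum_smul, ← hnorm]
    congr 1
    push_cast
    rw [Finset.mul_sum]
    refine Finset.sum_congr rfl fun i _ => ?_
    linear_combination -(2 * (Real.pi : ℂ)) ^ 2 * (inner ℝ ξ (e i) : ℝ) ^ 2 * Complex.I_sq
  have hd := fun i => fderiv_fourier_potentialSymbol hE H x (e i)
  calc ∑ i, c i (fderiv ℝ (𝓕 (potentialSymbol h)) x (e i))
      = ∑ i, c i (𝓕 (fun ξ => (-(2 * Real.pi * Complex.I) * (inner ℝ ξ (e i) : ℝ)) •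
          potentialSymbol h ξ) x) := Finset.sum_congr rfl fun i _ => congrArg _ (hd i).2
    _ = 𝓕 (fun ξ => ∑ i, c i ((-(2 * Real.pi * Complex.I) * (inner ℝ ξ (e i) : ℝ)) •
          potentialSymbol h ξ)) x := (fourier_sum_clm c (fun i => (hd i).1) x).symm
    _ = 𝓕 (𝓕⁻ g) x := by
        rw [Real.fourier_eq, Real.fourier_eq]
        have : Nontrivial (EuclideanSpace ℝ ι) :=
          Module.nontrivial_of_finrank_pos (R := ℝ) (by omega)
        -- At `ξ = 0` the inverse in `potentialSymbol` takes the value `0`, so the two integrands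
        -- are compared off this null set.
        have hne : ∀ᵐ ξ : EuclideanSpace ℝ ι, ξ ≠ 0 := by simp [ae_iff]
        refine integral_congr_ae ?_
        filter_upwards [hne] with ξ hξ
        congr 1
        have hpos : (((2 * Real.pi) ^ 2 * ‖ξ‖ ^ 2 : ℝ) : ℂ) ≠ 0 := by
          have := norm_pos_iff.2 hξ
          exact Complex.ofReal_ne_zero.2 (by positivity)
        rw [← inv_smul_smul₀ hpos (𝓕⁻ g ξ), ← hsymb ξ, Finset.smul_sum]
        refine Finset.sum_congr rfl fun i _ => ?_
        rw [potentialSymbol, ← map_smul, smul_comm]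
    _ = g x := by
        have hG : g = G := rfl
        have h8 : 𝓕 (𝓕⁻ G) = G := FourierTransform.fourier_fourierInv_eq G
        rw [hG, ← SchwartzMap.fourierInv_coe, ← SchwartzMap.fourier_coe, h8]

end PotentialSystem

/-! ### Calculus of directional derivatives -/

section DirDeriv

variable {E F : Type} [NormedAddCommGroup E] [NormedSpace ℝ E] [NormedAddCommGroup F]
  [NormedSpace ℂ F]

/-- The derivative of `f` in direction `a`, as a function. -/
noncomputable def pd (a : E) (f : E → F) : E → F := fun x => fderiv ℝ f x a

theorem contDiff_pd {f : E → F} (hf : ContDiff ℝ ∞ f) (a : E) : ContDiff ℝ ∞ (pd a f) :=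
  (hf.fderiv_right (m := ∞) (by simp)).clm_apply contDiff_const

theorem pd_comm {f : E → F} (hf : ContDiff ℝ ∞ f) (a b : E) : pd a (pd b f) = pd b (pd a f) := by
  ext x
  have hd : DifferentiableAt ℝ (fderiv ℝ f) x :=
    ((hf.fderiv_right (m := ∞) (by simp)).differentiable (by simp)).differentiableAt
  have h : ∀ a b, pd a (pd b f) x = fderiv ℝ (fderiv ℝ f) x a b := fun a b => by
    have := (hd.hasFDerivAt.clm_apply (hasFDerivAt_const b x)).fderiv
    unfold pd
    rw [this]
    simp
  rw [h, h]
  exact (hf.contDiffAt.isSymmSndFDerivAt (by simpa using WithTop.coe_le_coe.2 (le_top : (2 : ℕ∞) ≤ ⊤))) a b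

theorem pd_sum_clm {κ : Type} [Fintype κ] (c : κ → F →L[ℂ] F) {f : κ → E → F}
    (hf : ∀ i, ContDiff ℝ ∞ (f i)) (a : E) :
    pd a (fun x => ∑ i, c i (f i x)) = fun x => ∑ i, c i (pd a (f i) x) := by
  ext x
  have h : ∀ i, HasFDerivAt (fun x => c i (f i x)) _ x := fun i =>
    ((c i).restrictScalars ℝ).hasFDerivAt.comp x
      (((hf i).differentiable (by simp)).differentiableAt.hasFDerivAt)
  unfold pd
  rw [(HasFDerivAt.fun_sum fun i _ => h i).fderiv, sum_apply]
  rfl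

theorem contDiff_sum_clm {κ : Type} [Fintype κ] (c : κ → F →L[ℂ] F) {f : κ → E → F}
    (hf : ∀ i, ContDiff ℝ ∞ (f i)) : ContDiff ℝ ∞ fun x => ∑ i, c i (f i x) :=
  ContDiff.sum fun i _ => ((c i).restrictScalars ℝ).contDiff.comp (hf i)

theorem eventuallyEq_pd {f g : E → F} {x : E} (h : f =ᶠ[𝓝 x] g) (a : E) :
    pd a f =ᶠ[𝓝 x] pd a g := by
  filter_upwards [h.fderiv (𝕜 := ℝ)] with y hy
  rw [pd, pd, hy]

theorem pd_zero (a : E) : pd a (fun _ => 0 : E → F) = fun _ => 0 := by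
  ext x; simp [pd]

end DirDeriv

/-! ### The Dirac operators of a Clifford module -/

section DiracSystem

variable {n : ℕ} {F : Type} [NormedAddCommGroup F] [NormedSpace ℂ F] {γ : Fin n → F →L[ℂ] F}

/-- The Dirac operator in the `A`-th vector variable. -/
noncomputable def diracOp (γ : Fin n → F →L[ℂ] F) (A : Fin 2) (u : TwoVec n → F) : TwoVec n → F :=
  fun x => ∑ j, γ j (pd (EuclideanSpace.single (A, j) 1) u x)

/-- The Clifford relations. -/
def IsClifford (γ : Fin n → F →L[ℂ] F) : Prop :=
  ∀ i j v, γ i (γ j v) + γ j (γ i v) = if i = j then (-2 : ℂ) • v else 0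

/-- `u` solves the Dirac equation in both vector variables on `s`. -/
structure IsDiracSolOn (γ : Fin n → F →L[ℂ] F) (u : TwoVec n → F) (s : Set (TwoVec n)) : Prop where
  differentiableAt : ∀ x ∈ s, DifferentiableAt ℝ u x
  eq_zero : ∀ A, ∀ x ∈ s, diracOp γ A u x = 0

theorem IsDiracSolOn.mono {u : TwoVec n → F} {s t : Set (TwoVec n)} (h : IsDiracSolOn γ u t)
    (hst : s ⊆ t) : IsDiracSolOn γ u s :=
  ⟨fun x hx => h.1 x (hst hx), fun A x hx => h.2 A x (hst hx)⟩

theorem diracOp_sub {u v : TwoVec n → F} {x : TwoVec n} (hu : DifferentiableAt ℝ u x)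
    (hv : DifferentiableAt ℝ v x) (A : Fin 2) :
    diracOp γ A (fun y => u y - v y) x = diracOp γ A u x - diracOp γ A v x := by
  simp only [diracOp, pd, fderiv_fun_sub hu hv, sub_apply, map_sub, Finset.sum_sub_distrib]

theorem IsDiracSolOn.sub {u v : TwoVec n → F} {s : Set (TwoVec n)} (hu : IsDiracSolOn γ u s)
    (hv : IsDiracSolOn γ v s) : IsDiracSolOn γ (fun x => u x - v x) s :=
  ⟨fun x hx => (hu.1 x hx).sub (hv.1 x hx), fun A x hx => by
    rw [diracOp_sub (hu.1 x hx) (hv.1 x hx), hu.2 A x hx, hv.2 A x hx, sub_zero]⟩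

theorem eventuallyEq_diracOp {u v : TwoVec n → F} {x : TwoVec n} (h : u =ᶠ[𝓝 x] v) (A : Fin 2) :
    diracOp γ A u =ᶠ[𝓝 x] diracOp γ A v := by
  have : ∀ᶠ y in 𝓝 x, u =ᶠ[𝓝 y] v := eventually_eventually_nhds.2 h
  filter_upwards [this] with y hy
  simp only [diracOp, (eventuallyEq_pd hy _).self_of_nhds]

theorem diracOp_zero (A : Fin 2) : diracOp γ A (fun _ => 0) = fun _ => 0 := by
  ext x
  simp [diracOp, pd_zero]

theorem contDiff_diracOp {u : TwoVec n → F} (hu : ContDiff ℝ ∞ u) (A : Fin 2) :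
    ContDiff ℝ ∞ (diracOp γ A u) :=
  contDiff_sum_clm γ fun _ => contDiff_pd hu _

/-- Symmetry of `T` replaces each product `γ i γ j` by half the anticommutator. It is applied to the
second derivatives, which turns `D_A²` into `-Δ_A`. -/
theorem sum_clifford (hγ : IsClifford γ) {T : Fin n → Fin n → F} (hT : ∀ i j, T i j = T j i) :
    ∑ i, ∑ j, γ i (γ j (T i j)) = -∑ i, T i i := by
  have h1 : ∑ i, ∑ j, γ i (γ j (T i j)) = ∑ i, ∑ j, γ j (γ i (T i j)) := by
    rw [Finset.sum_comm]
    exact Finset.sum_congr rfl fun i _ => Finset.sum_congr rfl fun j _ => by rw [hT]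
  have h2 : (2 : ℂ) • ∑ i, ∑ j, γ i (γ j (T i j)) = (2 : ℂ) • -∑ i, T i i := by
    rw [two_smul]
    nth_rw 2 [h1]
    simp only [← Finset.sum_add_distrib, hγ _ _ _, Finset.sum_ite_eq, Finset.mem_univ, if_true]
    rw [← Finset.smul_sum]
    module
  exact smul_right_injective F (two_ne_zero' ℂ) h2

theorem diracOp_diracOp (hγ : IsClifford γ) {u : TwoVec n → F} (hu : ContDiff ℝ ∞ u) (A : Fin 2) :
    diracOp γ A (diracOp γ A u) = fun x => -∑ j, pd (EuclideanSpace.single (A, j) 1)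
      (pd (EuclideanSpace.single (A, j) 1) u) x := by
  ext x
  rw [← sum_clifford hγ (T := fun i j => pd (EuclideanSpace.single (A, i) 1)
      (pd (EuclideanSpace.single (A, j) 1) u) x) fun i j => by rw [pd_comm hu]]
  unfold diracOp
  simp only [pd_sum_clm γ fun j => contDiff_pd hu (EuclideanSpace.single (A, j) 1), map_sum]

/-- Commutation of the Dirac operator with the Laplacian. -/
theorem diracOp_sum_diracOp_diracOp (hγ : IsClifford γ) {u : TwoVec n → F} (hu : ContDiff ℝ ∞ u)
    (A : Fin 2) (x : TwoVec n) :
    diracOp γ A (fun y => ∑ B, diracOp γ B (diracOp γ B u) y) x =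
      -∑ i : Fin 2 × Fin n, pd (EuclideanSpace.single i 1)
        (pd (EuclideanSpace.single i 1) (diracOp γ A u)) x := by
  have h1 : (fun y => ∑ B, diracOp γ B (diracOp γ B u) y) = fun y =>
      ∑ i : Fin 2 × Fin n, (-ContinuousLinearMap.id ℂ F) (pd (EuclideanSpace.single i 1)
        (pd (EuclideanSpace.single i 1) u) y) := by
    ext y
    simp [diracOp_diracOp hγ hu, Fintype.sum_prod_type]
  have hcd : ∀ i : Fin 2 × Fin n, ContDiff ℝ ∞ (pd (EuclideanSpace.single i (1 : ℝ))
      (pd (EuclideanSpace.single i 1) u)) := fun i => contDiff_pd (contDiff_pd hu _) _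
  rw [h1]
  unfold diracOp
  simp only [pd_sum_clm _ hcd, pd_sum_clm γ fun j => contDiff_pd hu (EuclideanSpace.single (A, j) 1),
    pd_sum_clm γ fun j => contDiff_pd (contDiff_pd hu (EuclideanSpace.single (A, j) 1)) _, map_sum]
  rw [Finset.sum_comm, ← Finset.sum_neg_distrib]
  refine Finset.sum_congr rfl fun i _ => ?_
  rw [← Finset.sum_neg_distrib]
  refine Finset.sum_congr rfl fun j _ => ?_
  rw [neg_apply, map_neg, ContinuousLinearMap.id_apply, pd_comm (contDiff_pd hu _), pd_comm hu]

variable [CompleteSpace F]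

/-- Multiplying `D_A u = 0` by each `-γ i` gives a system with `B_pq = -γ_p γ_q` inside one vector
variable and `0` across the two; the Clifford relations are exactly `B_pq + B_qp = 2δ_pq`. -/
theorem IsDiracSolOn.meanValueOn (hn : 0 < n) (hγ : IsClifford γ) {u : TwoVec n → F}
    {s : Set (TwoVec n)} (hu : IsDiracSolOn γ u s) : MeanValueOn u s := by
  have : Nonempty (Fin 2 × Fin n) := ⟨(0, ⟨0, hn⟩)⟩
  refine meanValueOn_of_system (B := fun p q => if p.1 = q.1 then
    -((γ p.2).comp (γ q.2)).restrictScalars ℝ else 0) (fun p q v => ?_) hu.1 fun z hz p => ?_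
  · by_cases h : p.1 = q.1
    · have h2 := hγ p.2 q.2 v
      have h3 : p = q ↔ p.2 = q.2 := by rw [Prod.ext_iff]; simp [h]
      simp only [h, h3, if_true, neg_apply, ContinuousLinearMap.coe_restrictScalars',
        ContinuousLinearMap.comp_apply, ← neg_add, h2]
      split_ifs
      · rw [← neg_smul, neg_neg, two_smul, two_smul]
      · simp
    · have h3 : p ≠ q := fun h' => h (by rw [h'])
      simp [h, Ne.symm h, h3]
  · have h2 := hu.2 p.1 z hz
    rw [Fintype.sum_prod_type, Finset.sum_eq_single p.1]
    · simp only [if_true, neg_apply, ContinuousLinearMap.coe_restrictScalars',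
        ContinuousLinearMap.comp_apply, Finset.sum_neg_distrib, ← map_sum]
      unfold diracOp pd at h2
      rw [h2, map_zero, neg_zero]
    · intro A _ hA
      simp [Ne.symm hA]
    · simp

/-- The inclusion of the first vector variable. -/
noncomputable def inclZero (n : ℕ) : EuclideanSpace ℝ (Fin n) →L[ℝ] TwoVec n :=
  LinearMap.toContinuousLinearMap
    { toFun := fun y => WithLp.toLp 2 fun q => if q.1 = 0 then y q.2 else 0
      map_add' := fun y z => by ext q; by_cases h : q.1 = 0 <;> simp [h]
      map_smul' := fun c y => by ext q; by_cases h : q.1 = 0 <;> simp [h] }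

theorem inclZero_apply (y : EuclideanSpace ℝ (Fin n)) (q : Fin 2 × Fin n) :
    inclZero n y q = if q.1 = 0 then y q.2 else 0 := rfl

theorem inclZero_single (j : Fin n) :
    inclZero n (EuclideanSpace.single j 1) = EuclideanSpace.single (0, j) 1 := by
  ext ⟨A, i⟩
  rw [inclZero_apply]
  by_cases h : A = 0 <;> simp [h]

/-- A slice is a closed embedding, so decay at infinity is inherited by restriction to it. -/
theorem tendsto_add_inclZero (a : TwoVec n) :
    Tendsto (fun y => a + inclZero n y) (cocompact _) (cocompact _) := by
  have hinj : LinearMap.ker (inclZero n : EuclideanSpace ℝ (Fin n) →ₗ[ℝ] TwoVec n) = ⊥ := by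
    rw [LinearMap.ker_eq_bot]
    intro y z h
    ext j
    have := congrArg (fun w : TwoVec n => w (0, j)) h
    simpa [inclZero_apply] using this
  have h1 := (LinearMap.isClosedEmbedding_of_injective hinj).tendsto_cocompact
  exact (Homeomorph.addLeft a).isClosedEmbedding.tendsto_cocompact.comp h1

/-- Liouville's theorem on the slices `x₁ = const`. -/
theorem eq_zero_of_slice (hn : 0 < n) (hγ : IsClifford γ) {v : TwoVec n → F}
    (hv : Differentiable ℝ v) (h0 : Tendsto v (cocompact _) (𝓝 0)) (a : TwoVec n)
    (ha : ∀ y, diracOp γ 0 v (a + inclZero n y) = 0) : v a = 0 := by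
  have : Nonempty (Fin n) := ⟨⟨0, hn⟩⟩
  have hd : ∀ y, HasFDerivAt (fun y => v (a + inclZero n y))
      ((fderiv ℝ v (a + inclZero n y)).comp (inclZero n)) y := fun y =>
    (hv _).hasFDerivAt.comp y ((inclZero n).hasFDerivAt.const_add a)
  have hmv : MeanValueOn (fun y => v (a + inclZero n y)) univ := by
    refine meanValueOn_of_system (B := fun i j => -((γ i).comp (γ j)).restrictScalars ℝ)
      (fun i j w => ?_) (fun y _ => (hd y).differentiableAt) fun y _ i => ?_
    · have h2 := hγ i j w
      simp only [neg_apply, ContinuousLinearMap.coe_restrictScalars',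
        ContinuousLinearMap.comp_apply, ← neg_add, h2]
      split_ifs
      · rw [← neg_smul, neg_neg, two_smul, two_smul]
      · simp
    · have h2 := ha y
      simp only [neg_apply, ContinuousLinearMap.coe_restrictScalars',
        ContinuousLinearMap.comp_apply, Finset.sum_neg_distrib, ← map_sum, (hd y).fderiv,
        inclZero_single]
      unfold diracOp pd at h2
      rw [h2, map_zero, neg_zero]
  simpa using hmv.eq_zero_of_tendsto (h0.comp (tendsto_add_inclZero a)) 0

end DiracSystem

/-! ### The Hartogs extension for Clifford modules -/

section Extension

theorem exists_smooth_cutoff {E : Type} [NormedAddCommGroup E] [NormedSpace ℝ E]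
    [FiniteDimensional ℝ E] {K Ω : Set E} (hK : IsCompact K) (hΩ : IsOpen Ω) (h : K ⊆ Ω) :
    ∃ χ : E → ℝ, ContDiff ℝ ∞ χ ∧ HasCompactSupport χ ∧ tsupport χ ⊆ Ω ∧
      ∀ x ∈ K, χ =ᶠ[𝓝 x] fun _ => 1 := by
  obtain ⟨K', hK', hKK', hK'Ω⟩ := exists_compact_between hK hΩ h
  obtain ⟨f, hf1, hf0, -⟩ := exists_contMDiffMap_one_nhds_of_subset_interior 𝓘(ℝ, E) (n := ⊤)
    hK.isClosed hKK'
  have hsub : tsupport f ⊆ K' :=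
    closure_minimal (fun x hx => by_contra fun h => hx (hf0 x h)) hK'.isClosed
  exact ⟨f, f.contMDiff.contDiff, hK'.of_isClosed_subset (isClosed_tsupport _) hsub,
    hsub.trans hK'Ω, fun x hx => eventually_nhdsSet_iff_forall.1 hf1 x hx⟩

variable {n : ℕ} {F : Type} [NormedAddCommGroup F] [NormedSpace ℂ F] [CompleteSpace F]
  {γ : Fin n → F →L[ℂ] F}

/-- A system `D_A v = g_A` that is locally solvable near its compact support has a global solution
that tends to zero at infinity. -/
theorem exists_solution_tendsto_zero (hn : 2 ≤ n) (hγ : IsClifford γ) {L : Set (TwoVec n)}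
    (hL : IsCompact L) {f : TwoVec n → F} (hf : ContDiff ℝ ∞ f) {g : Fin 2 → TwoVec n → F}
    (hgL : ∀ A, ∀ x ∉ L, g A x = 0) (hg : ∀ A, ∀ x ∈ L, g A =ᶠ[𝓝 x] diracOp γ A f) :
    ∃ v : TwoVec n → F, Differentiable ℝ v ∧ Tendsto v (cocompact _) (𝓝 0) ∧
      ∀ A x, diracOp γ A v x = g A x := by
  have hgL' : ∀ A, ∀ x ∉ L, g A =ᶠ[𝓝 x] fun _ => 0 := fun A x hx => by
    filter_upwards [hL.isClosed.isOpen_compl.mem_nhds hx] with y hy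
    exact hgL A y hy
  have hgs : ∀ A, ContDiff ℝ ∞ (g A) := fun A => contDiff_iff_contDiffAt.2 fun x => by
    by_cases hx : x ∈ L
    · exact (contDiff_diracOp hf A).contDiffAt.congr_of_eventuallyEq (hg A x hx)
    · exact contDiffAt_const.congr_of_eventuallyEq (hgL' A x hx)
  have hgc : ∀ A, HasCompactSupport (g A) := fun A => HasCompactSupport.intro hL (hgL A)
  -- Near `L` this is `∑_B D_B² f = -Δ f`, hence `D_A h = -Δ (D_A f) = -Δ g_A`, the compatibility
  -- that `exists_potential` asks for; off `L` both sides vanish.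
  let h : TwoVec n → F := fun x => ∑ B, diracOp γ B (g B) x
  have hhL : ∀ x ∉ L, h =ᶠ[𝓝 x] fun _ => 0 := fun x hx => by
    filter_upwards [eventually_all.2 fun B => eventuallyEq_diracOp (γ := γ) (hgL' B x hx) B]
      with y hy
    simp [h, hy, diracOp_zero]
  have hhs : ContDiff ℝ ∞ h := ContDiff.sum fun B _ => contDiff_diracOp (hgs B) B
  have hhc : HasCompactSupport h := HasCompactSupport.intro hL fun x hx =>
    (hhL x hx).self_of_nhds
  obtain ⟨v, hv, hv0, hsol⟩ := exists_potential (by simp; omega) hhc hhs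
  have hsum : ∀ (w : TwoVec n → F) (A : Fin 2) (x : TwoVec n), ∑ i : Fin 2 × Fin n,
      (if i.1 = A then γ i.2 else 0) (fderiv ℝ w x (EuclideanSpace.single i 1)) =
      diracOp γ A w x := fun w A x => by
    rw [Fintype.sum_prod_type, Finset.sum_eq_single A]
    · simp [diracOp, pd]
    · intro B _ hB
      simp [hB]
    · simp
  refine ⟨v, hv, hv0, fun A x => ?_⟩
  rw [← hsum]
  refine hsol _ (g A) (hgc A) (hgs A) (fun x => ?_) x
  rw [hsum]
  by_cases hx : x ∈ L
  · have h1 : h =ᶠ[𝓝 x] fun y => ∑ B, diracOp γ B (diracOp γ B f) y := by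
      filter_upwards [eventually_all.2 fun B => eventuallyEq_diracOp (γ := γ) (hg B x hx) B]
        with y hy
      simp [h, hy]
    rw [(eventuallyEq_diracOp h1 A).self_of_nhds, diracOp_sum_diracOp_diracOp hγ hf]
    congr 1
    refine Finset.sum_congr rfl fun i _ => ?_
    exact (eventuallyEq_pd (eventuallyEq_pd (hg A x hx) _) _).self_of_nhds.symm
  · rw [(eventuallyEq_diracOp (hhL x hx) A).self_of_nhds, diracOp_zero, eq_comm, neg_eq_zero]
    refine Finset.sum_eq_zero fun i _ => ?_
    have := (eventuallyEq_pd (eventuallyEq_pd (hgL' A x hx) (EuclideanSpace.single i 1))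
      (EuclideanSpace.single i 1)).self_of_nhds
    rw [pd_zero, pd_zero] at this
    exact this

/-- A solution outside of a compact set that tends to zero at infinity vanishes near some point of
any given neighbourhood of this compact set. -/
theorem exists_eventuallyEq_zero (hn : 0 < n) (hγ : IsClifford γ) {L Ω : Set (TwoVec n)}
    (hL : IsCompact L) (hne : L.Nonempty) (hΩ : IsOpen Ω) (hLΩ : L ⊆ Ω) {v : TwoVec n → F}
    (hv : Differentiable ℝ v) (hv0 : Tendsto v (cocompact _) (𝓝 0))
    (hsol : IsDiracSolOn γ v Lᶜ) : ∃ q ∈ Ω \ L, v =ᶠ[𝓝 q] 0 := by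
  obtain ⟨p, hp⟩ := hne
  obtain ⟨R, hR⟩ := hL.isBounded.subset_closedBall 0
  -- A coordinate of the second vector variable is constant on the slices `x₁ = const`, so a slice
  -- on which it exceeds `R` in absolute value misses `L`.
  let i : Fin 2 × Fin n := (1, ⟨0, hn⟩)
  let ℓ : ℝ → TwoVec n := fun t => p + t • EuclideanSpace.single i 1
  have hℓ : Continuous ℓ := by fun_prop
  have hℓi : ∀ t, ℓ t i = p i + t := fun t => by simp [ℓ]
  have hfar : ∀ x : TwoVec n, R < |x i| → x ∉ L := fun x hx hxL => by
    have h1 := PiLp.norm_apply_le x i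
    have h2 := mem_closedBall_zero_iff.1 (hR hxL)
    rw [Real.norm_eq_abs] at h1
    linarith
  have hvfar : ∀ x : TwoVec n, R < |x i| → v x = 0 := fun x hx =>
    eq_zero_of_slice hn hγ hv hv0 x fun y => hsol.2 0 _ <| hfar _ <| by
      have : (x + inclZero n y) i = x i := by
        simp [i, inclZero_apply]
      rwa [this]
  let T : Set ℝ := {t | 0 ≤ t ∧ ℓ t ∈ L}
  have hTc : IsCompact T := by
    refine (isCompact_Icc (a := 0) (b := |R| + |p i|)).of_isClosed_subset
      (isClosed_Ici.inter (hL.isClosed.preimage hℓ)) fun t ht => ⟨ht.1, ?_⟩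
    by_contra! hlt
    refine hfar (ℓ t) ?_ ht.2
    rw [hℓi]
    have h1 := neg_abs_le (p i)
    have h2 := le_abs_self R
    exact lt_of_lt_of_le (by linarith) (le_abs_self _)
  -- The ray from `p` leaves `L` for good at the parameter `t`; the point sought lies just behind
  -- it, still in `Ω`.
  obtain ⟨t, ht, htmax⟩ := hTc.exists_isGreatest ⟨0, le_rfl, by simpa [ℓ] using hp⟩
  obtain ⟨ε, hε, hball⟩ := Metric.isOpen_iff.1 (hΩ.preimage hℓ) t (hLΩ ht.2)
  have hray : ∀ s, t < s → ℓ s ∉ L := fun s hs hsL =>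
    absurd (htmax ⟨ht.1.trans hs.le, hsL⟩) (not_le.2 hs)
  set t₁ := t + ε / 2 with ht₁
  have htt₁ : t < t₁ := by linarith
  refine ⟨ℓ t₁, ⟨hball (by rw [mem_ball, Real.dist_eq, ht₁, add_sub_cancel_left,
    abs_of_pos (by positivity)]; linarith), hray _ htt₁⟩, ?_⟩
  have hpre : IsPreconnected (ℓ '' Ici t₁) := isPreconnected_Ici.image _ hℓ.continuousOn
  set t₂ := max t₁ (|R| + |p i| + 1) with ht₂
  have hbig : R < |ℓ t₂ i| := by
    rw [hℓi]
    have h1 := neg_abs_le (p i)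
    have h2 := le_abs_self R
    have h3 : |R| + |p i| + 1 ≤ t₂ := le_max_right _ _
    exact lt_of_lt_of_le (by linarith) (le_abs_self _)
  -- The rest of the ray avoids `L`, so the vanishing at the far point `ℓ t₂` propagates back to `ℓ
  -- t₁`.
  refine (hsol.meanValueOn hn hγ).eventuallyEq_zero_of_isPreconnected hL.isClosed.isOpen_compl hpre
    ?_ (p := ℓ t₂) ⟨t₂, mem_Ici.2 (le_max_left _ _), rfl⟩ ?_ _ ⟨t₁, mem_Ici.2 le_rfl, rfl⟩
  · rintro _ ⟨s, hs, rfl⟩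
    exact hray s (htt₁.trans_le hs)
  · have hopen : IsOpen {x : TwoVec n | R < |x i|} :=
      isOpen_lt continuous_const (by fun_prop)
    filter_upwards [hopen.mem_nhds hbig] with x hx
    exact hvfar x hx

/-- Hartogs' phenomenon for functions with values in a Clifford module. -/
theorem exists_extension (hn : 2 ≤ n) (hγ : IsClifford γ) {Ω K : Set (TwoVec n)} (hΩ : IsOpen Ω)
    (hK : IsCompact K) (hKΩ : K ⊆ Ω) (hconn : IsPreconnected (Ω \ K)) {u : TwoVec n → F}
    (hu : IsDiracSolOn γ u (Ω \ K)) :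
    ∃ U : TwoVec n → F, IsDiracSolOn γ U Ω ∧ EqOn U u (Ω \ K) := by
  rcases K.eq_empty_or_nonempty with rfl | hKne
  · exact ⟨u, by simpa using hu, fun _ _ => rfl⟩
  have hn0 : 0 < n := by omega
  have hopen : IsOpen (Ω \ K) := hΩ.sdiff hK.isClosed
  have hus := (hu.meanValueOn hn0 hγ).contDiffOn hopen
  obtain ⟨χ, hχs, hχc, hχΩ, hχK⟩ := exists_smooth_cutoff hK hΩ hKΩ
  obtain ⟨ψ, hψs, hψc, hψΩ, hψχ⟩ := exists_smooth_cutoff (K := tsupport χ) hχc hΩ hχΩ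
  have hKχ : K ⊆ tsupport χ := fun x hx => subset_tsupport χ (by
    rw [mem_support, (hχK x hx).self_of_nhds]; exact one_ne_zero)
  let f : TwoVec n → F := fun x => (1 - χ x) • u x
  have hfK : ∀ x ∈ K, f =ᶠ[𝓝 x] fun _ => 0 := fun x hx => by
    filter_upwards [hχK x hx] with y hy
    simp [f, hy]
  have hfs : ∀ x ∈ Ω, ContDiffAt ℝ ∞ f x := fun x hx => by
    by_cases hxK : x ∈ K
    · exact contDiffAt_const.congr_of_eventuallyEq (hfK x hxK)
    · exact (contDiff_const.sub hχs).contDiffAt.smul (hus.contDiffAt (hopen.mem_nhds ⟨hx, hxK⟩))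
  -- The function `f` is controlled only on `Ω`; this version is smooth on the whole space and
  -- agrees with `f` near `tsupport χ`, where alone it is used.
  let f' : TwoVec n → F := fun x => ψ x • f x
  have hf's : ContDiff ℝ ∞ f' := contDiff_iff_contDiffAt.2 fun x => by
    by_cases hx : x ∈ Ω
    · exact hψs.contDiffAt.smul (hfs x hx)
    · refine contDiffAt_const (c := (0 : F)) |>.congr_of_eventuallyEq ?_
      filter_upwards [(isClosed_tsupport ψ).isOpen_compl.mem_nhds fun h => hx (hψΩ h)] with y hy
      simp [f', image_eq_zero_of_notMem_tsupport hy]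
  have hff' : ∀ x ∈ tsupport χ, f' =ᶠ[𝓝 x] f := fun x hx => by
    filter_upwards [hψχ x hx] with y hy
    simp [f', hy]
  have hfu : ∀ x ∉ tsupport χ, f =ᶠ[𝓝 x] u := fun x hx => by
    filter_upwards [(isClosed_tsupport χ).isOpen_compl.mem_nhds hx] with y hy
    simp [f, image_eq_zero_of_notMem_tsupport hy]
  -- The indicator discards the meaningless values of `D_A f` outside `Ω`; inside `Ω` it changes
  -- nothing, because `f = u` off `tsupport χ`.
  let g : Fin 2 → TwoVec n → F := fun A => (tsupport χ).indicator (diracOp γ A f)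
  have hgf : ∀ A, ∀ x ∈ Ω, g A x = diracOp γ A f x := fun A x hx => by
    by_cases hxχ : x ∈ tsupport χ
    · exact indicator_of_mem hxχ _
    · rw [(eventuallyEq_diracOp (hfu x hxχ) A).self_of_nhds,
        hu.2 A x ⟨hx, fun h => hxχ (hKχ h)⟩]
      exact indicator_of_notMem hxχ _
  obtain ⟨v, hv, hv0, hvg⟩ := exists_solution_tendsto_zero hn hγ hχc hf's (g := g)
    (fun A x hx => indicator_of_notMem hx _) fun A x hx => by
      filter_upwards [hΩ.mem_nhds (hχΩ hx), eventuallyEq_diracOp (γ := γ) (hff' x hx) A]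
        with y hy hy'
      rw [hgf A y hy, hy']
  obtain ⟨q, hq, hvq⟩ := exists_eventuallyEq_zero hn0 hγ hχc (hKne.mono hKχ) hΩ hχΩ hv hv0
    ⟨fun x _ => hv x, fun A x hx => by rw [hvg]; exact indicator_of_notMem hx _⟩
  have hU : IsDiracSolOn γ (fun x => f x - v x) Ω := by
    have hfd : ∀ x ∈ Ω, DifferentiableAt ℝ f x := fun x hx => (hfs x hx).differentiableAt (by simp)
    exact ⟨fun x hx => (hfd x hx).sub (hv x), fun A x hx => by
      rw [diracOp_sub (hfd x hx) (hv x), hvg, hgf A x hx, sub_self]⟩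
  refine ⟨_, hU, fun x hx => ?_⟩
  have hdiff := (hU.mono sdiff_subset).sub hu
  -- Near `q` both `v = 0` and `f = u`, so `f - v - u` vanishes there and hence on the connected set
  -- `Ω \ K`.
  have h0 := (hdiff.meanValueOn hn0 hγ).eventuallyEq_zero_of_isPreconnected hopen hconn
    Subset.rfl (p := q) ⟨hq.1, fun h => hq.2 (hKχ h)⟩ (by
      filter_upwards [hvq, hfu q hq.2] with y hy hy'
      simp [hy, hy']) x hx
  exact sub_eq_zero.1 h0.self_of_nhds

end Extension

/-! ### Return to `𝕊⁺`-valued functions -/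

section Spinors

variable {n : ℕ}

/-- The Dirac matrices as continuous linear maps. -/
noncomputable def gammaCLM (j : Fin n) : Spinor n →L[ℂ] Spinor n :=
  LinearMap.toContinuousLinearMap (diracMatrix j)

theorem gammaCLM_apply (j : Fin n) (ψ : Spinor n) : gammaCLM j ψ = diracMatrix j ψ := rfl

theorem isClifford_gammaCLM : IsClifford (gammaCLM (n := n)) := fun i j v => by
  have h := LinearMap.congr_fun (diracMatrix_anticomm i j) v
  simp only [gammaCLM_apply]
  rw [LinearMap.add_apply, Module.End.mul_apply, Module.End.mul_apply] at h
  rw [h]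
  split_ifs <;> simp

theorem coe_nablaD {u : TwoVec n → spinPlus n} {x : TwoVec n} (hu : DifferentiableAt ℝ u x)
    (A : Fin 2) : (nablaD A u x : Spinor n) = diracOp gammaCLM A (fun y => (u y : Spinor n)) x := by
  have hd : HasFDerivAt (fun y => (u y : Spinor n))
      (((spinPlus n).subtypeL.restrictScalars ℝ).comp (fderiv ℝ u x)) x :=
    ((spinPlus n).subtypeL.restrictScalars ℝ).hasFDerivAt.comp x hu.hasFDerivAt
  simp only [nablaD, diracOp, pd, hd.fderiv, Submodule.coe_sum]
  rfl

theorem isDiracSolOn_coe {u : TwoVec n → spinPlus n} {s : Set (TwoVec n)} (hu : IsMonogenicOn u s) :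
    IsDiracSolOn gammaCLM (fun x => (u x : Spinor n)) s where
  differentiableAt x hx :=
    ((spinPlus n).subtypeL.restrictScalars ℝ).differentiableAt.comp x (hu.1 x hx)
  eq_zero A x hx := by
    rw [← coe_nablaD (hu.1 x hx)]
    have := congrFun (hu.2 x hx) A
    simp only [diracDZero, Pi.zero_apply] at this
    rw [this, Submodule.coe_zero]

theorem isMonogenicOn_of_coe {u : TwoVec n → spinPlus n} {s : Set (TwoVec n)}
    (hu : IsDiracSolOn gammaCLM (fun x => (u x : Spinor n)) s) : IsMonogenicOn u s := by
  have hd : ∀ x ∈ s, DifferentiableAt ℝ u x := fun x hx => by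
    -- Differentiability into the subspace is recovered by composing with a continuous projection
    -- onto it.
    have h := ((spinPlus n).orthogonalProjectionOnto.restrictScalars ℝ).differentiableAt.comp x
      (hu.1 x hx)
    refine h.congr_of_eventuallyEq (Eventually.of_forall fun y => ?_)
    exact (Submodule.orthogonalProjectionOnto_mem_subspace_eq_self (u y)).symm
  refine ⟨hd, fun x hx => ?_⟩
  ext1 A
  refine Subtype.ext ?_
  exact (coe_nablaD (hd x hx) A).trans (hu.2 A x hx)

/-- Evenness of `n` excludes the last Dirac matrix of the odd case, which is a multiple of the
parity operator and commutes with it. -/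
theorem parityOp_diracMatrix (hn : Even n) (j : Fin n) (ψ : Spinor n) :
    diracMatrix j (parityOp ψ) = -parityOp (diracMatrix j ψ) := by
  have h1 : ∀ k, wedgeOp k (parityOp ψ) = -parityOp (wedgeOp k ψ) := fun k =>
    eq_neg_of_add_eq_zero_right (LinearMap.congr_fun (parityOp_wedgeOp k) ψ)
  have h2 : ∀ k, contractOp k (parityOp ψ) = -parityOp (contractOp k ψ) := fun k =>
    eq_neg_of_add_eq_zero_right (LinearMap.congr_fun (parityOp_contractOp k) ψ)
  rcases diracMatrix_cases j with ⟨k, -, e⟩ | ⟨k, -, e⟩ | ⟨h, -⟩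
  · rw [e, LinearMap.sub_apply, LinearMap.sub_apply, h1, h2, map_sub]
    abel
  · rw [e, LinearMap.smul_apply, LinearMap.smul_apply, LinearMap.add_apply, LinearMap.add_apply,
      h1, h2, map_smul, map_add]
    module
  · obtain ⟨r, hr⟩ := hn
    have := j.2
    omega

/-- The projection of the spinor space to its even part. -/
noncomputable def evenProj (n : ℕ) : Spinor n →L[ℂ] Spinor n :=
  LinearMap.toContinuousLinearMap ((1 / 2 : ℂ) • (LinearMap.id + parityOp))

theorem evenProj_apply (ψ : Spinor n) : evenProj n ψ = (1 / 2 : ℂ) • (ψ + parityOp ψ) := rfl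

theorem evenProj_mem (ψ : Spinor n) : evenProj n ψ ∈ spinPlus n := fun _ α hα => by
  rw [evenProj_apply]
  simp [parityOp_apply, hα.neg_one_pow]

theorem evenProj_of_mem (hn : Even n) {ψ : Spinor n} (hψ : ψ ∈ spinPlus n) :
    evenProj n ψ = ψ := by
  ext α
  rw [evenProj_apply]
  rcases Nat.even_or_odd α.card with h | h
  · simp [parityOp_apply, h.neg_one_pow]
    ring
  · simp [hψ hn α h, parityOp_apply]

/-- With `P` the parity operator, anticommutation gives `D_A (1 + P) u = (1 - P) D_A u = 0`. -/
theorem IsDiracSolOn.evenProj (hn : Even n) {u : TwoVec n → Spinor n} {s : Set (TwoVec n)}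
    (hu : IsDiracSolOn gammaCLM u s) : IsDiracSolOn gammaCLM (fun x => evenProj n (u x)) s where
  differentiableAt x hx :=
    ((Hartogs.evenProj n).restrictScalars ℝ).differentiableAt.comp x (hu.1 x hx)
  eq_zero A x hx := by
    have hd : HasFDerivAt (fun y => Hartogs.evenProj n (u y))
        (((Hartogs.evenProj n).restrictScalars ℝ).comp (fderiv ℝ u x)) x :=
      ((Hartogs.evenProj n).restrictScalars ℝ).hasFDerivAt.comp x (hu.1 x hx).hasFDerivAt
    have h := hu.2 A x hx
    simp only [diracOp, pd, hd.fderiv, ContinuousLinearMap.comp_apply,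
      ContinuousLinearMap.coe_restrictScalars'] at h ⊢
    simp only [gammaCLM_apply, evenProj_apply, map_smul, map_add,
      parityOp_diracMatrix hn] at h ⊢
    rw [← Finset.smul_sum, Finset.sum_add_distrib, Finset.sum_neg_distrib, ← map_sum, h]
    simp

theorem exists_coe_extension (hn : 2 ≤ n) {Ω K : Set (TwoVec n)} (hΩ : IsOpen Ω)
    (hK : IsCompact K) (hKΩ : K ⊆ Ω) (hconn : IsPreconnected (Ω \ K)) {u : TwoVec n → spinPlus n}
    (hu : IsMonogenicOn u (Ω \ K)) :
    ∃ U : TwoVec n → spinPlus n, IsMonogenicOn U Ω ∧ EqOn U u (Ω \ K) := by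
  obtain ⟨U, hU, hUu⟩ := exists_extension hn isClifford_gammaCLM hΩ hK hKΩ hconn
    (isDiracSolOn_coe hu)
  -- The extension takes values in the full spinor space. For even `n` its odd part is projected
  -- away, which leaves it unchanged on `Ω \ K`, where it equals `u`.
  rcases Nat.even_or_odd n with he | ho
  · refine ⟨fun x => ⟨evenProj n (U x), evenProj_mem _⟩,
      isMonogenicOn_of_coe (IsDiracSolOn.evenProj he hU), fun x hx => Subtype.ext ?_⟩
    simp only [hUu hx]
    exact evenProj_of_mem he (u x).2
  · refine ⟨fun x => ⟨U x, fun h => absurd h (Nat.not_even_iff_odd.2 ho)⟩,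
      isMonogenicOn_of_coe hU, fun x hx => Subtype.ext (hUu hx)⟩

/-- For `n = 1` the operator `∇_A` is a single derivative followed by `γ`, which is injective
because `γ² = -1`. -/
theorem fderiv_eq_zero_of_one {u : TwoVec 1 → spinPlus 1} {x : TwoVec 1}
    (hu : diracDZero u x = 0) : fderiv ℝ u x = 0 := by
  have h1 : ∀ A : Fin 2, fderiv ℝ u x (EuclideanSpace.single (A, 0) 1) = 0 := fun A => by
    have h2 : diracMatrix (0 : Fin 1)
        (fderiv ℝ u x (EuclideanSpace.single (A, 0) 1) : Spinor 1) = 0 := by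
      have h := congrArg (Subtype.val (p := (· ∈ spinMinus 1))) (congrFun hu A)
      simpa [diracDZero, nablaD, partialD, gammaPlus] using h
    have h3 := isClifford_gammaCLM (n := 1) 0 0
      (fderiv ℝ u x (EuclideanSpace.single (A, 0) 1) : Spinor 1)
    simp only [gammaCLM_apply, h2, map_zero, add_zero, if_true] at h3
    exact Subtype.ext ((smul_eq_zero.1 h3.symm).resolve_left (by norm_num))
  refine ContinuousLinearMap.coe_injective ((EuclideanSpace.basisFun _ ℝ).toBasis.ext fun q => ?_)
  obtain ⟨A, j⟩ := q
  have hj : j = 0 := Subsingleton.elim _ _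
  subst hj
  simpa using h1 A

end Spinors

end Hartogs

/-! ### The theorem, including the small dimensions -/

theorem theorem1p2 (n : ℕ) (Ω K : Set (TwoVec n)) (hΩ : IsOpen Ω) (hK : IsCompact K)
    (hKΩ : K ⊆ Ω) (hconn : IsPreconnected (Ω \ K)) (u : TwoVec n → spinPlus n)
    (hu : IsMonogenicOn u (Ω \ K)) :
    ∃ U : TwoVec n → spinPlus n, IsMonogenicOn U Ω ∧ Set.EqOn U u (Ω \ K) := by
  -- The potential needs `2n ≥ 3`. For `n = 0` the space is a point and the equations are empty; for
  -- `n = 1` monogenic functions have zero derivative, so `u` is constant on the connected set `Ω \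
  -- K` and the constant extends it.
  rcases Nat.lt_or_ge n 2 with hn | hn
  · interval_cases n
    · refine ⟨u, ⟨fun x _ => ?_, fun x _ => ?_⟩, fun _ _ => rfl⟩
      · have : u = fun _ => u 0 := funext fun y => congrArg u (Subsingleton.elim _ _)
        rw [this]
        exact differentiableAt_const _
      · ext1 A
        simp [diracDZero, nablaD]
    · obtain ⟨a, ha⟩ := (hΩ.sdiff hK.isClosed).exists_is_const_of_fderiv_eq_zero (𝕜 := ℝ) hconn
        (fun x hx => (hu.differentiableAt x hx).differentiableWithinAt)
        (fun x hx => Hartogs.fderiv_eq_zero_of_one (hu.eq_zero x hx))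
      refine ⟨fun _ => a, ⟨fun x _ => differentiableAt_const a, fun x _ => ?_⟩,
        fun x hx => (ha x hx).symm⟩
      ext1 A
      simp [diracDZero, nablaD, partialD]
  · exact Hartogs.exists_coe_extension hn hΩ hK hKΩ hconn hu
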